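/- Let $m,n\ge 1$ and let $\lambda\subseteq\nu$ be (possibly empty) partitions contained in the rectangle $(n-1)^{m-1}$. For a partition $\mu=(\mu_1\ge\mu_2\ge\cdots)$ with $\lambda\subseteq\mu\subseteq\nu$ let $M^\mu$ be the $m\times n$ matrix with $M^\mu_{1,\mu_1+1}=1$; with $M^\mu_{k+1,\mu_{k+1}+1}=1$ and $M^\mu_{k+1,\mu_k+1}=-1$ whenever $1\le k\le m-1$ and $\mu_k>\mu_{k+1}$; and with all other entries $0$. Let $\mathrm{PASM}(\nu/\lambda)=\mathrm{PASM}(\nu/\lambda,m,n)\subset\mathbb R^{mn}$ be the convex hull of the matrices $M^\mu$, $\lambda\subseteq\mu\subseteq\nu$. Let $P=P(\nu/\lambda)$ be the poset of boxes $(i,j)$ of $\nu$ not in $\lambda$, ordered componentwise, and let $\widehat P$ be $P$ with a new minimum $\widehat 0$ and a new maximum $\widehat 1$ adjoined. A poset $P$ is strongly planar if the Hasse diagram of $\widehat P$ (each covering pair $p\lessdot q$ being drawn as a curve going upwards from $p$ to $q$) has an embedding in the plane without crossings, with larger elements at larger height. Let $H$ be the plane graph obtained from such a drawing by adding two further (upward)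 edges from $\widehat 0$ to $\widehat 1$, one to the left and one to the right of everything else. Let $G_P$ be the truncated dual of $H$, i.e. the dual graph of $H$ with the vertex of the infinite face deleted: its vertices are the bounded faces of $H$, its edges are dual to the edges of the Hasse diagram of $\widehat P$, and the edge dual to $p\lessdot q$ is directed from the face on the left of the curve from $p$ to $q$ to the face on its right (so that $q$ lies on the left and $p$ on the right when the dual edge is traversed). For a connected graph $G$ on $[k]=\{1,\dots,k\}$ with edges directed from the smaller to the larger vertex, the flow polytope $\mathcal F_G\subset\mathbb R^{E(G)}$ is the set of functions $fl:E(G)\to\mathbb R_{\ge0}$ such that the total flow on the edges leaving vertex $1$ is $1$, the total flow on the edges entering vertex $k$ is $1$, and at each other vertex the total incoming flow equals the total outgoing flow. Sets $\mathcal P\subset\mathbb R^d$ and $\mathcal Q\subset\mathbb R^r$ are integrally equivalent if some affine map $\mathbb R^d\to\mathbb R^r$ maps $\mathcal P$ bijectively onto $\mathcal Q$ and $\mathbb Z^d\cap\mathrm{aff}(\mathcal P)$ bijectively onto $\mathbb Z^r\cap\mathrm{aff}(\mathcal Q)$. Then the poset $P(\nu/\lambda)$ is strongly planar, and a plane graph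 $H$ as above exists. For every such $H$, the graph $G=G_{P(\nu/\lambda)}$ is connected and its vertices can be numbered $1,\dots,k$ so that all edges are directed from the smaller to the larger vertex; and for every such numbering $\mathrm{PASM}(\nu/\lambda)$ is integrally equivalent to the flow polytope $\mathcal F_{G}$. -/

import Mathlib

open Set Filter Topology

noncomputable section

/-! ### Integral equivalence -/

/-- The lattice `ℤ^ι` inside `ℝ^ι`. -/
def integerPoints (ι : Type*) : Set (ι → ℝ) :=
  {x | ∀ i, ∃ z : ℤ, x i = z}

/-- `P ⊆ ℝ^ι` and `Q ⊆ ℝ^κ` are integrally equivalent: some affine map `ℝ^ι → ℝ^κ` maps `P`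
bijectively onto `Q` and `ℤ^ι ∩ aff P` bijectively onto `ℤ^κ ∩ aff Q`. -/
def IntegrallyEquivalent {ι κ : Type*} (P : Set (ι → ℝ)) (Q : Set (κ → ℝ)) : Prop :=
  ∃ f : (ι → ℝ) →ᵃ[ℝ] (κ → ℝ),
    BijOn f P Q ∧
    BijOn f (integerPoints ι ∩ (affineSpan ℝ P : Set (ι → ℝ)))
      (integerPoints κ ∩ (affineSpan ℝ Q : Set (κ → ℝ)))

/-! ### The partial alternating sign matrix polytope of a skew shape

A partition is a Young diagram `μ`. Indices start at `0`: `μ.rowLen i` is the part `μ_{i+1}`, and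
the box in row `i + 1` and column `j + 1` is the pair `(i, j)`. -/

/-- Entries of the matrix `M^μ` (rows and columns counted from `0`). The first row has a single `1`,
in column `μ_1 + 1` (counted from `1`). If `μ_k > μ_{k+1}`, then row `k + 1` has a `1` in column
`μ_{k+1} + 1` and a `-1` in column `μ_k + 1`. All other entries vanish. -/
def partitionMatrixEntry (μ : YoungDiagram) : ℕ → ℕ → ℤ
  | 0, j => if j = μ.rowLen 0 then 1 else 0
  | k + 1, j =>
    if μ.rowLen (k + 1) < μ.rowLen k then
      if j = μ.rowLen (k + 1) then 1 else if j = μ.rowLen k then -1 else 0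
    else 0

/-- The `m × n` matrix `M^μ(m, n)`. -/
def partitionMatrix (μ : YoungDiagram) (m n : ℕ) : Matrix (Fin m) (Fin n) ℤ :=
  Matrix.of fun i j => partitionMatrixEntry μ i j

/-- `PASM(ν/λ, m, n)`: the convex hull in `ℝ^{mn}` of the matrices `M^μ(m, n)`, `λ ⊆ μ ⊆ ν`. -/
def pasmPolytope (nu lam : YoungDiagram) (m n : ℕ) : Set (Fin m × Fin n → ℝ) :=
  convexHull ℝ
    {v | ∃ μ : YoungDiagram, lam ≤ μ ∧ μ ≤ nu ∧
      v = fun c => (partitionMatrix μ m n c.1 c.2 : ℝ)}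

/-- The poset `P(ν/λ)`: the boxes of `ν` that are not in `λ`, ordered componentwise. -/
abbrev SkewPoset (nu lam : YoungDiagram) : Type :=
  {c : ℕ × ℕ // c ∈ nu ∧ c ∉ lam}

instance instFiniteSkewPoset (nu lam : YoungDiagram) : Finite (SkewPoset nu lam) :=
  Set.Finite.to_subtype (nu.cells.finite_toSet.subset fun _ hc => hc.1)

/-! ### Strongly planar posets -/

/-- `P` with a new minimum `⊥` and a new maximum `⊤` adjoined. -/
abbrev PosetHat (P : Type*) : Type _ := WithBot (WithTop P)

/-- The edges of the Hasse diagram of `PosetHat P`: the covering pairs `p ⋖ q`. -/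
abbrev HasseEdge (P : Type*) [PartialOrder P] : Type _ :=
  {e : PosetHat P × PosetHat P // e.1 ⋖ e.2}

instance instFiniteHasseEdge (P : Type*) [PartialOrder P] [Finite P] : Finite (HasseEdge P) :=
  haveI : Finite (PosetHat P) := inferInstanceAs (Finite (Option (Option P)))
  inferInstance

instance instFintypeHasseEdge (P : Type*) [PartialOrder P] [Finite P] : Fintype (HasseEdge P) :=
  Fintype.ofFinite _

/-- A planar embedding of the Hasse diagram of `PosetHat P` in which larger elements lie higher.
As usual for Hasse diagrams, the edge `p ⋖ q` is a curve going upwards from `p` to `q`; so it is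
given by its horizontal coordinate as a function of the height in `[height p, height q]`
(the values of the function outside this interval play no role). -/
structure HasseDrawing (P : Type*) [PartialOrder P] where
  /-- the position of a vertex, horizontal coordinate first -/
  pos : PosetHat P → ℝ × ℝ
  pos_injective : Function.Injective pos
  height_strictMono : StrictMono fun p => (pos p).2
  curve : HasseEdge P → ℝ → ℝ
  curve_continuousOn : ∀ e : HasseEdge P,
    ContinuousOn (curve e) (Icc (pos e.1.1).2 (pos e.1.2).2)
  curve_lower : ∀ e : HasseEdge P, curve e (pos e.1.1).2 = (pos e.1.1).1
  curve_upper : ∀ e : HasseEdge P, curve e (pos e.1.2).2 = (pos e.1.2).1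
  /-- an edge passes through no vertices but its two ends -/
  vertex_on_curve : ∀ (e : HasseEdge P) (v : PosetHat P),
    (pos v).2 ∈ Icc (pos e.1.1).2 (pos e.1.2).2 → curve e (pos v).2 = (pos v).1 →
      v = e.1.1 ∨ v = e.1.2
  /-- two different edges meet only in vertices (hence only in common ends) -/
  curve_inter : ∀ (e e' : HasseEdge P) (y : ℝ), e ≠ e' →
    y ∈ Icc (pos e.1.1).2 (pos e.1.2).2 → y ∈ Icc (pos e'.1.1).2 (pos e'.1.2).2 →
      curve e y = curve e' y → ∃ v : PosetHat P, pos v = (curve e y, y)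

/-- A poset `P` is strongly planar if the Hasse diagram of `PosetHat P` has such an embedding. -/
def StronglyPlanar (P : Type*) [PartialOrder P] : Prop :=
  Nonempty (HasseDrawing P)

/-- A planar embedding of the augmented Hasse diagram `H`: the Hasse diagram of `PosetHat P` with two
additional edges from `⊥` to `⊤`, one to the left and one to the right of everything else. -/
structure AugmentedDrawing (P : Type*) [PartialOrder P] extends HasseDrawing P where
  leftCurve : ℝ → ℝ
  rightCurve : ℝ → ℝ
  left_continuousOn : ContinuousOn leftCurve (Icc (pos ⊥).2 (pos ⊤).2)
  right_continuousOn : ContinuousOn rightCurve (Icc (pos ⊥).2 (pos ⊤).2)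
  left_bot : leftCurve (pos ⊥).2 = (pos ⊥).1
  left_top : leftCurve (pos ⊤).2 = (pos ⊤).1
  right_bot : rightCurve (pos ⊥).2 = (pos ⊥).1
  right_top : rightCurve (pos ⊤).2 = (pos ⊤).1
  left_lt : ∀ y ∈ Ioo (pos ⊥).2 (pos ⊤).2, ∀ e : HasseEdge P,
    y ∈ Icc (pos e.1.1).2 (pos e.1.2).2 → leftCurve y < curve e y
  lt_right : ∀ y ∈ Ioo (pos ⊥).2 (pos ⊤).2, ∀ e : HasseEdge P,
    y ∈ Icc (pos e.1.1).2 (pos e.1.2).2 → curve e y < rightCurve y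

/-! ### The truncated dual -/

namespace AugmentedDrawing

variable {P : Type*} [PartialOrder P]

/-- The subset of the plane covered by the drawing of `H` (every vertex is the end of an edge). -/
def support (D : AugmentedDrawing P) : Set (ℝ × ℝ) :=
  {z | ∃ e : HasseEdge P, z.2 ∈ Icc (D.pos e.1.1).2 (D.pos e.1.2).2 ∧ z.1 = D.curve e z.2} ∪
  {z | z.2 ∈ Icc (D.pos ⊥).2 (D.pos ⊤).2 ∧ (z.1 = D.leftCurve z.2 ∨ z.1 = D.rightCurve z.2)}

/-- The faces of `H`: the connected components of the complement of the drawing. -/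
def IsFace (D : AugmentedDrawing P) (F : Set (ℝ × ℝ)) : Prop :=
  ∃ z ∈ D.supportᶜ, F = connectedComponentIn D.supportᶜ z

/-- The faces of `H` other than the infinite one. -/
def BoundedFace (D : AugmentedDrawing P) : Type :=
  {F : Set (ℝ × ℝ) // D.IsFace F ∧ Bornology.IsBounded F}

/-- The face `F` lies along the edge `e`, on its left. -/
def IsLeftFace (D : AugmentedDrawing P) (F : Set (ℝ × ℝ)) (e : HasseEdge P) : Prop :=
  ∀ y ∈ Ioo (D.pos e.1.1).2 (D.pos e.1.2).2, ∀ᶠ x in 𝓝[<] (D.curve e y), (x, y) ∈ F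

/-- The face `F` lies along the edge `e`, on its right. -/
def IsRightFace (D : AugmentedDrawing P) (F : Set (ℝ × ℝ)) (e : HasseEdge P) : Prop :=
  ∀ y ∈ Ioo (D.pos e.1.1).2 (D.pos e.1.2).2, ∀ᶠ x in 𝓝[>] (D.curve e y), (x, y) ∈ F

end AugmentedDrawing

/-- A connected (multi)graph on the vertex set `Fin k` (the vertices `1, …, k` counted from `0`) with
edge set `E`; the edges are directed from the smaller to the larger vertex. -/
structure OrderedGraph (k : ℕ) (E : Type*) where
  tail : E → Fin k
  head : E → Fin k
  tail_lt_head : ∀ e, tail e < head e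
  connected : (SimpleGraph.fromRel fun u v => ∃ e, tail e = u ∧ head e = v).Connected

/-- `G` is the graph `G_P` obtained from the drawing `D`: the truncated dual of `H`. Its vertices,
numbered `1, …, k` in an order compatible with the orientation, are the bounded faces of `H`. Its
edges are dual to the edges of the Hasse diagram of `PosetHat P`; the duals of the two additional
edges of `H` are incident with the infinite face and are deleted together with it. The edge dual to
`p ⋖ q` has the upper vertex `q` on its left and the lower vertex `p` on its right; so it leads from
the face on the left of the curve from `p` up to `q` to the face on the right of it. -/
def IsTruncatedDual {P : Type*} [PartialOrder P] (D : AugmentedDrawing P) {k : ℕ}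
    (G : OrderedGraph k (HasseEdge P)) : Prop :=
  ∃ φ : Fin k ≃ D.BoundedFace, ∀ e : HasseEdge P,
    D.IsLeftFace (φ (G.tail e)).1 e ∧ D.IsRightFace (φ (G.head e)).1 e

/-! ### Flow polytopes -/

/-- The flow polytope of `G`: the flows of size one from the first vertex to the last one. -/
def flowPolytope {k : ℕ} {E : Type*} [Fintype E] (G : OrderedGraph k E) : Set (E → ℝ) :=
  {fl | (∀ e, 0 ≤ fl e) ∧
    ∑ e with (G.tail e : ℕ) = 0, fl e = 1 ∧
    ∑ e with (G.head e : ℕ) + 1 = k, fl e = 1 ∧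
    ∀ v : Fin k, 0 < (v : ℕ) → (v : ℕ) + 1 < k →
      ∑ e with G.head e = v, fl e = ∑ e with G.tail e = v, fl e}

end

/-! The corner sums of `M^μ` form the indicator function of the complement of `μ`
(`cornerSum_partitionPoint`). Passing from entries to corner sums is a unimodular change of
coordinates. On the affine hull of the polytope, the corner sums at boxes of `λ` are `0` and those
outside `ν` are `1`. The remaining ones are indexed by `P(ν/λ)` and identify `PASM(ν/λ)` with the
order polytope, i.e. the order preserving functions `P → [0, 1]` (`exists_mem_pasmPolytope`).

Extend such a function `f` by `f ⊥ = 0` and `f ⊤ = 1` and send it to its differences `f q - f p`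
along the Hasse edges. Nothing is lost over `ℤ`, since `f` is recovered by adding differences
upwards from `⊥`. The image is the flow polytope of the truncated dual (`mem_flowPolytope_iff`).
This is planar duality between potentials and flows, and it rests on two facts.

First, let `g` be a function of the bounded faces. Its jumps across the edges entering an inner
vertex from below and across those leaving it upwards have equal sums. Summation by parts then
evaluates the pairing of the differences of `f` with the jumps of `g` as `(f ⊤ - f ⊥) * (g sink - g
source)` (`sum_diff_mul_jump`). With `g` the indicator of one face, this is flow conservation at
that face.

Second, a maximal chain separates the drawing: the indicator of its right side jumps by one across
the edges of the chain and across no others (`IsChainCurve.exists_side`). Pairing it with a flow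
shows that the flow on each maximal chain sums to `1`. Hence the sum along a chain from `⊥` to `p`
depends only on `p`, and it gives back `f`. Adding such indicators also yields a potential
increasing from left to right across every edge, so the dual graph is acyclic and can be numbered.

All curves are graphs over the height, so the topology of faces reduces to horizontal segments and
thin strips along curves. A skew shape is drawn by rotating its boxes by 45 degrees. -/

noncomputable section

set_option linter.unusedSectionVars false

/-! ### Finite families of curves in the plane -/

/-- A family of curves in the plane, each the graph of a horizontal coordinate over an interval of
heights, such that the interior of each curve is disjoint from all others. -/
structure CurveSystem (ι : Type*) where
  lo : ι → ℝ
  hi : ι → ℝ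
  lo_lt_hi : ∀ i, lo i < hi i
  curve : ι → ℝ → ℝ
  continuous_curve : ∀ i, Continuous (curve i)
  curve_ne : ∀ i j y, i ≠ j → y ∈ Ioo (lo i) (hi i) → y ∈ Icc (lo j) (hi j) →
    curve i y ≠ curve j y

namespace CurveSystem

variable {ι : Type*} (C : CurveSystem ι)

def trace (i : ι) : Set (ℝ × ℝ) := {z | z.2 ∈ Icc (C.lo i) (C.hi i) ∧ z.1 = C.curve i z.2}

def support : Set (ℝ × ℝ) := {z | ∃ i, z ∈ C.trace i}

/-- The component of a point in the complement of the curves. -/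
def component (z : ℝ × ℝ) : Set (ℝ × ℝ) := connectedComponentIn C.supportᶜ z

lemma isClosed_trace (i : ι) : IsClosed (C.trace i) := by
  have h := C.continuous_curve i
  exact (isClosed_Icc.preimage continuous_snd).inter
    (isClosed_eq continuous_fst (h.comp continuous_snd))

lemma isClosed_traces [Finite ι] (p : ι → Prop) : IsClosed {z | ∃ i, p i ∧ z ∈ C.trace i} := by
  have : {z | ∃ i, p i ∧ z ∈ C.trace i} = ⋃ i ∈ {i | p i}, C.trace i := by
    ext z; simp
  rw [this]
  exact (Set.toFinite _).isClosed_biUnion fun i _ => C.isClosed_trace i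

lemma isClosed_support [Finite ι] : IsClosed C.support := by
  have := C.isClosed_traces fun _ => True
  simpa [support] using this

lemma component_eq_of_mem {s : Set (ℝ × ℝ)} (hs : IsPreconnected s) (hsC : s ⊆ C.supportᶜ)
    {z w : ℝ × ℝ} (hz : z ∈ s) (hw : w ∈ s) : C.component z = C.component w :=
  connectedComponentIn_eq (hs.subset_connectedComponentIn hz hsC hw)

lemma component_eq_of_segment {y x₁ x₂ : ℝ} (h : x₁ ≤ x₂)
    (hC : ∀ x ∈ Icc x₁ x₂, (x, y) ∉ C.support) :
    C.component (x₁, y) = C.component (x₂, y) := by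
  have hs : IsPreconnected ((fun x : ℝ => (x, y)) '' Icc x₁ x₂) :=
    isPreconnected_Icc.image _ (by fun_prop)
  refine C.component_eq_of_mem hs ?_ ⟨x₁, ⟨le_rfl, h⟩, rfl⟩ ⟨x₂, ⟨h, le_rfl⟩, rfl⟩
  rintro _ ⟨x, hx, rfl⟩
  exact hC x hx

lemma component_eq_of_vertical {x y₁ y₂ : ℝ} (h : y₁ ≤ y₂)
    (hC : ∀ y ∈ Icc y₁ y₂, (x, y) ∉ C.support) :
    C.component (x, y₁) = C.component (x, y₂) := by
  have hs : IsPreconnected ((fun y : ℝ => (x, y)) '' Icc y₁ y₂) :=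
    isPreconnected_Icc.image _ (by fun_prop)
  refine C.component_eq_of_mem hs ?_ ⟨y₁, ⟨le_rfl, h⟩, rfl⟩ ⟨y₂, ⟨h, le_rfl⟩, rfl⟩
  rintro _ ⟨y, hy, rfl⟩
  exact hC y hy

/-- The other curves form a closed set that misses an interior point of curve `i`. A thin strip on
one side of that point therefore meets no curve, and it is connected as the continuous image of a
rectangle. The sign of `σ` selects the side. -/
lemma exists_tube [Finite ι] (i : ι) {σ : ℝ} (hσ : σ ≠ 0) {y₀ : ℝ}
    (hy₀ : y₀ ∈ Ioo (C.lo i) (C.hi i)) :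
    ∃ ε > 0, ∃ F, ∀ t ∈ Ioo 0 ε, ∀ y ∈ Ioo (y₀ - ε) (y₀ + ε),
      (C.curve i y + σ * t, y) ∉ C.support ∧ C.component (C.curve i y + σ * t, y) = F := by
  have hcont := C.continuous_curve i
  have hK := C.isClosed_traces fun j => j ≠ i
  set K := {z | ∃ j, j ≠ i ∧ z ∈ C.trace j} with hKdef
  have hg : Continuous fun p : ℝ × ℝ => (C.curve i p.2 + σ * p.1, p.2) := by fun_prop
  have h1 : ∀ᶠ p : ℝ × ℝ in 𝓝 (0, y₀), (C.curve i p.2 + σ * p.1, p.2) ∉ K := by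
    refine hg.continuousAt.eventually (hK.isOpen_compl.mem_nhds ?_)
    rintro ⟨j, hj, h2, h3⟩
    exact C.curve_ne i j y₀ hj.symm hy₀ h2 (by simpa using h3)
  obtain ⟨ε, hε, hball⟩ := Metric.eventually_nhds_iff.1 h1
  have hout : ∀ t ∈ Ioo 0 ε, ∀ y ∈ Ioo (y₀ - ε) (y₀ + ε),
      (C.curve i y + σ * t, y) ∉ C.support := by
    rintro t ⟨ht, ht'⟩ y ⟨hy, hy'⟩ ⟨j, hj⟩
    by_cases hji : j = i
    · subst hji
      have : σ * t = 0 := by simpa using hj.2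
      rcases mul_eq_zero.1 this with h | h
      · exact hσ h
      · exact ht.ne' h
    · have hd : dist ((t, y) : ℝ × ℝ) (0, y₀) < ε := by
        rw [Prod.dist_eq, Real.dist_eq, Real.dist_eq]
        refine max_lt ?_ ?_ <;> rw [abs_lt] <;> constructor <;> simp <;> linarith
      exact hball hd ⟨j, hji, hj⟩
  have hs : IsPreconnected ((fun p : ℝ × ℝ => (C.curve i p.2 + σ * p.1, p.2)) ''
      (Ioo 0 ε ×ˢ Ioo (y₀ - ε) (y₀ + ε))) :=
    (isPreconnected_Ioo.prod isPreconnected_Ioo).image _ hg.continuousOn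
  refine ⟨ε, hε, C.component (C.curve i y₀ + σ * (ε / 2), y₀), fun t ht y hy =>
    ⟨hout t ht y hy, ?_⟩⟩
  refine C.component_eq_of_mem hs ?_ ⟨(t, y), ⟨ht, hy⟩, rfl⟩
    ⟨(ε / 2, y₀), ⟨⟨by simpa, by simp; linarith⟩, by simpa⟩, rfl⟩
  rintro _ ⟨⟨t, y⟩, ⟨ht, hy⟩, rfl⟩
  exact hout t ht y hy

/-- The component found locally by `exists_tube` is locally constant in the height, hence constant
on the connected open interval. -/
lemma exists_sideFace [Finite ι] (i : ι) {σ : ℝ} (hσ : σ ≠ 0) :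
    ∃ F, ∀ y ∈ Ioo (C.lo i) (C.hi i), ∀ᶠ t in 𝓝[>] (0 : ℝ),
      (C.curve i y + σ * t, y) ∉ C.support ∧ C.component (C.curve i y + σ * t, y) = F := by
  have hev : ∀ y₀ ∈ Ioo (C.lo i) (C.hi i), ∃ F, ∀ᶠ y in 𝓝 y₀, ∀ᶠ t in 𝓝[>] (0 : ℝ),
      (C.curve i y + σ * t, y) ∉ C.support ∧ C.component (C.curve i y + σ * t, y) = F := by
    intro y₀ hy₀
    obtain ⟨ε, hε, F, hF⟩ := C.exists_tube i hσ hy₀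
    refine ⟨F, ?_⟩
    filter_upwards [Ioo_mem_nhds (sub_lt_self y₀ hε) (lt_add_of_pos_right y₀ hε)] with y hy
    filter_upwards [Ioo_mem_nhdsGT hε] with t ht
    exact hF t ht y hy
  have hlt := C.lo_lt_hi i
  set m := (C.lo i + C.hi i) / 2 with hm
  have hmI : m ∈ Ioo (C.lo i) (C.hi i) := ⟨by linarith, by linarith⟩
  obtain ⟨F, hF⟩ := hev m hmI
  refine ⟨F, fun y hy => ?_⟩
  -- `Q` says that the same component lies beside the curve at both heights. It is transitive
  -- because two eventual statements about the same `t` hold together for some `t`.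
  let Q : ℝ → ℝ → Prop := fun y y' => ∃ F, (∀ᶠ t in 𝓝[>] (0 : ℝ),
      (C.curve i y + σ * t, y) ∉ C.support ∧ C.component (C.curve i y + σ * t, y) = F) ∧
      (∀ᶠ t in 𝓝[>] (0 : ℝ),
      (C.curve i y' + σ * t, y') ∉ C.support ∧ C.component (C.curve i y' + σ * t, y') = F)
  have hQ : Q m y := by
    refine isPreconnected_Ioo.induction₂ Q ?_ ?_ ?_ hmI hy
    · intro y₀ hy₀
      obtain ⟨F, hF⟩ := hev y₀ hy₀
      filter_upwards [nhdsWithin_le_nhds hF] with y hy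
      exact ⟨F, hF.self_of_nhds, hy⟩
    · rintro a b c - - - ⟨F, h1, h2⟩ ⟨F', h3, h4⟩
      obtain ⟨t, ht, ht'⟩ := (h2.and h3).exists
      obtain rfl : F = F' := ht.2.symm.trans ht'.2
      exact ⟨F, h1, h4⟩
    · rintro a b - - ⟨F, h1, h2⟩
      exact ⟨F, h2, h1⟩
  obtain ⟨F', h1, h2⟩ := hQ
  obtain ⟨t, ht, ht'⟩ := (hF.self_of_nhds.and h1).exists
  obtain rfl : F = F' := ht.2.symm.trans ht'.2
  exact h2

section Faces

variable [Finite ι]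

/-- The component that lies along the left side of a curve. -/
def leftFace (i : ι) : Set (ℝ × ℝ) :=
  (C.exists_sideFace i (σ := -1) (by norm_num)).choose

/-- The component that lies along the right side of a curve. -/
def rightFace (i : ι) : Set (ℝ × ℝ) :=
  (C.exists_sideFace i (σ := 1) (by norm_num)).choose

lemma eventually_leftFace (i : ι) {y : ℝ} (hy : y ∈ Ioo (C.lo i) (C.hi i)) :
    ∀ᶠ x in 𝓝[<] (C.curve i y), (x, y) ∉ C.support ∧ C.component (x, y) = C.leftFace i := by
  have h := (C.exists_sideFace i (σ := -1) (by norm_num)).choose_spec y hy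
  have ht : Tendsto (fun x => C.curve i y - x) (𝓝[<] (C.curve i y)) (𝓝[>] (0 : ℝ)) := by
    refine tendsto_nhdsWithin_iff.2 ⟨?_, ?_⟩
    · have : Continuous fun x => C.curve i y - x := by fun_prop
      simpa using (this.tendsto (C.curve i y)).mono_left nhdsWithin_le_nhds
    · filter_upwards [self_mem_nhdsWithin] with x hx
      simpa using hx
  filter_upwards [ht.eventually h] with x hx
  simpa [leftFace] using hx

lemma eventually_rightFace (i : ι) {y : ℝ} (hy : y ∈ Ioo (C.lo i) (C.hi i)) :
    ∀ᶠ x in 𝓝[>] (C.curve i y), (x, y) ∉ C.support ∧ C.component (x, y) = C.rightFace i := by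
  have h := (C.exists_sideFace i (σ := 1) (by norm_num)).choose_spec y hy
  have ht : Tendsto (fun x => x - C.curve i y) (𝓝[>] (C.curve i y)) (𝓝[>] (0 : ℝ)) := by
    refine tendsto_nhdsWithin_iff.2 ⟨?_, ?_⟩
    · have : Continuous fun x => x - C.curve i y := by fun_prop
      simpa using (this.tendsto (C.curve i y)).mono_left nhdsWithin_le_nhds
    · filter_upwards [self_mem_nhdsWithin] with x hx
      simpa using hx
  filter_upwards [ht.eventually h] with x hx
  simpa [rightFace] using hx

/-- Along a horizontal segment, the change of a function of the components is the sum of its jumps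
across the curves met by the segment. -/
lemma sum_jump_segment (g : Set (ℝ × ℝ) → ℝ) {y x₂ : ℝ} (h₂ : (x₂, y) ∉ C.support)
    (A : Finset ι) {x₁ : ℝ} (hx : x₁ < x₂) (h₁ : (x₁, y) ∉ C.support)
    (hA : ∀ i, i ∈ A ↔ y ∈ Icc (C.lo i) (C.hi i) ∧ C.curve i y ∈ Ioo x₁ x₂)
    (hint : ∀ i ∈ A, y ∈ Ioo (C.lo i) (C.hi i)) :
    ∑ i ∈ A, (g (C.rightFace i) - g (C.leftFace i)) =
      g (C.component (x₂, y)) - g (C.component (x₁, y)) := by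
  classical
  -- Induction on the number of curves met: the segment is restarted just to the right of its
  -- leftmost crossing.
  induction hn : A.card generalizing A x₁ with
  | zero =>
    obtain rfl := Finset.card_eq_zero.1 hn
    rw [C.component_eq_of_segment hx.le, Finset.sum_empty, sub_self]
    rintro x ⟨hx1, hx2⟩ ⟨i, hi, hi'⟩
    simp only at hi hi'
    rcases hx1.eq_or_lt with rfl | hx1
    · exact h₁ ⟨i, hi, hi'⟩
    rcases hx2.eq_or_lt with rfl | hx2
    · exact h₂ ⟨i, hi, hi'⟩
    · exact absurd ((hA i).2 ⟨hi, hi' ▸ ⟨hx1, hx2⟩⟩) (by simp)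
  | succ n ih =>
    have hne : A.Nonempty := by rw [← Finset.card_pos]; omega
    obtain ⟨i₀, hi₀, hmin⟩ := A.exists_min_image (fun i => C.curve i y) hne
    have hi₀' := (hA i₀).1 hi₀
    have hlt : ∀ i ∈ A, i ≠ i₀ → C.curve i₀ y < C.curve i y := fun i hi hne =>
      lt_of_le_of_ne (hmin i hi) (C.curve_ne i₀ i y hne.symm (hint i₀ hi₀) ((hA i).1 hi).1)
    -- a point just to the left of the first curve
    obtain ⟨a, ⟨ha, ha'⟩, ha1, ha2⟩ := ((C.eventually_leftFace i₀ (hint i₀ hi₀)).and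
      (Ioo_mem_nhdsLT hi₀'.2.1)).exists
    have hleft : C.component (x₁, y) = C.leftFace i₀ := by
      rw [← ha']
      refine C.component_eq_of_segment ha1.le ?_
      rintro x ⟨hx1, hx2⟩ ⟨i, hi, hi'⟩
      simp only at hi hi'
      rcases hx1.eq_or_lt with rfl | hx1
      · exact h₁ ⟨i, hi, hi'⟩
      · have : i ∈ A := (hA i).2 ⟨hi, hi' ▸ hx1, hi' ▸ ((hx2.trans_lt ha2).trans hi₀'.2.2)⟩
        have := hmin i this
        rw [← hi'] at this
        linarith
    -- a point just to the right of it
    have hev : ∀ᶠ x in 𝓝[>] (C.curve i₀ y), ∀ i ∈ A.erase i₀, x < C.curve i y := by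
      rw [Filter.eventually_all_finset]
      intro i hi
      rw [Finset.mem_erase] at hi
      exact nhdsWithin_le_nhds (Iio_mem_nhds (hlt i hi.2 hi.1))
    obtain ⟨b, ⟨⟨hb, hb'⟩, hb1, hb2⟩, hb3⟩ := (((C.eventually_rightFace i₀ (hint i₀ hi₀)).and
      (Ioo_mem_nhdsGT hi₀'.2.2)).and hev).exists
    have := ih (A.erase i₀) hb2 hb (fun i => ?_) (fun i hi => hint i (Finset.mem_of_mem_erase hi))
      (by rw [Finset.card_erase_of_mem hi₀, hn]; rfl)
    · rw [← Finset.add_sum_erase _ _ hi₀, this, hb', hleft]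
      ring
    · rw [Finset.mem_erase, hA]
      constructor
      · rintro ⟨hne, h1, h2, h3⟩
        exact ⟨h1, hb3 i (Finset.mem_erase.2 ⟨hne, (hA i).2 ⟨h1, h2, h3⟩⟩), h3⟩
      · rintro ⟨h1, h2, h3⟩
        refine ⟨?_, h1, ?_, h3⟩
        · rintro rfl
          linarith
        · linarith [hi₀'.2.1]

/-- The jumps across the curves that end in a vertex from below and from above have the same sum. -/
lemma sum_jump_vertex (g : Set (ℝ × ℝ) → ℝ) (v : ℝ × ℝ) (I O : Finset ι)
    (hI : ∀ i, i ∈ I ↔ C.hi i = v.2 ∧ C.curve i v.2 = v.1)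
    (hO : ∀ i, i ∈ O ↔ C.lo i = v.2 ∧ C.curve i v.2 = v.1)
    (hv : ∀ i, v ∈ C.trace i → C.hi i = v.2 ∨ C.lo i = v.2) :
    ∑ i ∈ I, (g (C.rightFace i) - g (C.leftFace i)) =
      ∑ i ∈ O, (g (C.rightFace i) - g (C.leftFace i)) := by
  classical
  obtain ⟨x₀, y₀⟩ := v
  simp only at hI hO hv
  -- The curves not ending in `v` form a closed set missing `v`, so a small box around `v` meets
  -- only curves from `I` and `O`.
  have hK := C.isClosed_traces fun j => j ∉ I ∧ j ∉ O
  set K := {z | ∃ j, (j ∉ I ∧ j ∉ O) ∧ z ∈ C.trace j} with hKdef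
  have hvK : (x₀, y₀) ∉ K := by
    rintro ⟨j, ⟨hj1, hj2⟩, hj⟩
    rcases hv j hj with h | h
    · exact hj1 ((hI j).2 ⟨h, hj.2.symm⟩)
    · exact hj2 ((hO j).2 ⟨h, hj.2.symm⟩)
  obtain ⟨r, hr, hball⟩ := Metric.eventually_nhds_iff.1 (hK.isOpen_compl.mem_nhds hvK)
  have hbox : ∀ x y, |x - x₀| < r → |y - y₀| < r → (x, y) ∉ K := fun x y hx hy =>
    hball (by rw [Prod.dist_eq]; exact max_lt hx hy)
  have hnear : ∀ᶠ y in 𝓝 y₀, ∀ i ∈ I ∪ O, |C.curve i y - x₀| < r / 2 := by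
    rw [Filter.eventually_all_finset]
    intro i hi
    have hc : C.curve i y₀ = x₀ := by
      rcases Finset.mem_union.1 hi with h | h
      · exact ((hI i).1 h).2
      · exact ((hO i).1 h).2
    have : Tendsto (fun y => |C.curve i y - x₀|) (𝓝 y₀) (𝓝 |C.curve i y₀ - x₀|) :=
      (((C.continuous_curve i).sub continuous_const).abs).tendsto y₀
    rw [hc, sub_self, abs_zero] at this
    exact this.eventually (Iio_mem_nhds (by linarith))
  have hlong : ∀ᶠ y in 𝓝 y₀, (∀ i ∈ I, C.lo i < y) ∧ ∀ i ∈ O, y < C.hi i := by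
    refine Filter.Eventually.and ?_ ?_ <;> rw [Filter.eventually_all_finset] <;> intro i hi
    · exact Ioi_mem_nhds (by rw [← ((hI i).1 hi).1]; exact C.lo_lt_hi i)
    · exact Iio_mem_nhds (by rw [← ((hO i).1 hi).1]; exact C.lo_lt_hi i)
  obtain ⟨δ, hδ, hδ'⟩ := Metric.eventually_nhds_iff.1 (hnear.and hlong)
  set ε := min δ r / 2 with hε
  have hmin : 0 < min δ r := lt_min hδ hr
  have hεpos : 0 < ε := by positivity
  have hεδ : ε < δ := by have := min_le_left δ r; linarith
  have hεr : ε < r := by have := min_le_right δ r; linarith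
  have hclose : ∀ y, |y - y₀| ≤ ε → (∀ i ∈ I ∪ O, |C.curve i y - x₀| < r / 2) ∧
      (∀ i ∈ I, C.lo i < y) ∧ ∀ i ∈ O, y < C.hi i := fun y hy =>
    hδ' (by rw [Real.dist_eq]; exact hy.trans_lt hεδ)
  have hmem : ∀ x y i, |x - x₀| ≤ r / 2 → |y - y₀| ≤ ε → (x, y) ∈ C.trace i → i ∈ I ∪ O := by
    intro x y i hx hy hi
    by_contra h
    rw [Finset.mem_union, not_or] at h
    exact hbox x y (by linarith) (by linarith) ⟨i, h, hi⟩
  -- Within height `ε` of `v` the curves of `I ∪ O` stay closer than `r / 2` to `x₀`, so the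
  -- vertical sides of the box are free of curves. The bottom side is then crossed exactly by `I`
  -- and the top side exactly by `O`, and both have their ends in the same two components.
  have hside : ∀ x y, |x - x₀| = r / 2 → |y - y₀| ≤ ε → (x, y) ∉ C.support := by
    rintro x y hx hy ⟨i, hi⟩
    have h1 := (hclose y hy).1 i (hmem x y i hx.le hy hi)
    have h2 : x = C.curve i y := hi.2
    rw [← h2, hx] at h1
    exact lt_irrefl _ h1
  have hr1 : |x₀ - r / 2 - x₀| = r / 2 := by rw [sub_sub_cancel_left, abs_neg, abs_of_pos (by linarith)]
  have hr2 : |x₀ + r / 2 - x₀| = r / 2 := by rw [add_sub_cancel_left, abs_of_pos (by linarith)]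
  have he1 : |y₀ - ε - y₀| ≤ ε := by rw [sub_sub_cancel_left, abs_neg, abs_of_pos hεpos]
  have he2 : |y₀ + ε - y₀| ≤ ε := by rw [add_sub_cancel_left, abs_of_pos hεpos]
  have hvert : ∀ x, |x - x₀| = r / 2 →
      C.component (x, y₀ - ε) = C.component (x, y₀ + ε) := fun x hx =>
    C.component_eq_of_vertical (by linarith) fun y hy =>
      hside x y hx (abs_le.2 ⟨by linarith [hy.1], by linarith [hy.2]⟩)
  have hlow := C.sum_jump_segment g (hside (x₀ + r / 2) (y₀ - ε) hr2 he1) I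
    (x₁ := x₀ - r / 2) (by linarith) (hside _ _ hr1 he1) (fun i => ?_) (fun i hi =>
      ⟨(hclose _ he1).2.1 i hi, by rw [((hI i).1 hi).1]; linarith⟩)
  · have hup := C.sum_jump_segment g (hside (x₀ + r / 2) (y₀ + ε) hr2 he2) O
      (x₁ := x₀ - r / 2) (by linarith) (hside _ _ hr1 he2) (fun i => ?_) (fun i hi =>
        ⟨by rw [((hO i).1 hi).1]; linarith, (hclose _ he2).2.2 i hi⟩)
    · rw [hlow, hup, hvert _ hr1, hvert _ hr2]
    · constructor
      · intro hi
        have h1 := abs_lt.1 ((hclose _ he2).1 i (Finset.mem_union_right _ hi))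
        exact ⟨⟨by rw [((hO i).1 hi).1]; linarith, ((hclose _ he2).2.2 i hi).le⟩,
          by linarith, by linarith⟩
      · rintro ⟨h1, h2, h3⟩
        rcases Finset.mem_union.1 (hmem (C.curve i (y₀ + ε)) (y₀ + ε) i
          (abs_le.2 ⟨by linarith, by linarith⟩) he2 ⟨h1, rfl⟩) with h | h
        · have h4 := h1.2
          rw [((hI i).1 h).1] at h4
          linarith
        · exact h
  · constructor
    · intro hi
      have h1 := abs_lt.1 ((hclose _ he1).1 i (Finset.mem_union_left _ hi))
      exact ⟨⟨((hclose _ he1).2.1 i hi).le, by rw [((hI i).1 hi).1]; linarith⟩,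
        by linarith, by linarith⟩
    · rintro ⟨h1, h2, h3⟩
      rcases Finset.mem_union.1 (hmem (C.curve i (y₀ - ε)) (y₀ - ε) i
        (abs_le.2 ⟨by linarith, by linarith⟩) he1 ⟨h1, rfl⟩) with h | h
      · exact h
      · have h4 := h1.1
        rw [((hO i).1 h).1] at h4
        linarith

end Faces

end CurveSystem

/-! ### The nearest curve to the left or right of a point -/

namespace CurveSystem

variable {ι : Type*} [Finite ι] (C : CurveSystem ι)

/-- Walk left to the nearest curve. The hypothesis `hy` excludes heights at which some curve ends,
since side faces are controlled only along the interior of a curve. -/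
lemma exists_component_eq_rightFace {x y : ℝ} (hxy : (x, y) ∉ C.support)
    (hy : ∀ i, y ∈ Icc (C.lo i) (C.hi i) → y ∈ Ioo (C.lo i) (C.hi i))
    (hex : ∃ i, y ∈ Icc (C.lo i) (C.hi i) ∧ C.curve i y < x) :
    ∃ i, y ∈ Ioo (C.lo i) (C.hi i) ∧ C.curve i y < x ∧ C.component (x, y) = C.rightFace i := by
  obtain ⟨i, ⟨hi, hix⟩, hmax⟩ := Set.exists_max_image
    {i | y ∈ Icc (C.lo i) (C.hi i) ∧ C.curve i y < x} (fun i => C.curve i y) (Set.toFinite _) hex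
  obtain ⟨a, ⟨-, ha'⟩, ha1, ha2⟩ := ((C.eventually_rightFace i (hy i hi)).and
      (Ioo_mem_nhdsGT hix)).exists
  refine ⟨i, hy i hi, hix, ?_⟩
  rw [← ha', C.component_eq_of_segment ha2.le]
  rintro b ⟨hb1, hb2⟩ ⟨j, hj, hj'⟩
  simp only at hj hj'
  rcases hb2.eq_or_lt with rfl | hb2
  · exact hxy ⟨j, hj, hj'⟩
  · have := hmax j ⟨hj, hj' ▸ hb2⟩
    linarith

lemma exists_component_eq_leftFace {x y : ℝ} (hxy : (x, y) ∉ C.support)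
    (hy : ∀ i, y ∈ Icc (C.lo i) (C.hi i) → y ∈ Ioo (C.lo i) (C.hi i))
    (hex : ∃ i, y ∈ Icc (C.lo i) (C.hi i) ∧ x < C.curve i y) :
    ∃ i, y ∈ Ioo (C.lo i) (C.hi i) ∧ x < C.curve i y ∧ C.component (x, y) = C.leftFace i := by
  obtain ⟨i, ⟨hi, hix⟩, hmin⟩ := Set.exists_min_image
    {i | y ∈ Icc (C.lo i) (C.hi i) ∧ x < C.curve i y} (fun i => C.curve i y) (Set.toFinite _) hex
  obtain ⟨a, ⟨-, ha'⟩, ha1, ha2⟩ := ((C.eventually_leftFace i (hy i hi)).and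
      (Ioo_mem_nhdsLT hix)).exists
  refine ⟨i, hy i hi, hix, ?_⟩
  rw [← ha', C.component_eq_of_segment ha1.le]
  rintro b ⟨hb1, hb2⟩ ⟨j, hj, hj'⟩
  simp only at hj hj'
  rcases hb1.eq_or_lt with rfl | hb1
  · exact hxy ⟨j, hj, hj'⟩
  · have := hmin j ⟨hj, hj' ▸ hb1⟩
    linarith

end CurveSystem

/-! ### Edges of a Hasse drawing at a given height -/

instance instFinitePosetHat (P : Type*) [Finite P] : Finite (PosetHat P) :=
  inferInstanceAs (Finite (Option (Option P)))

namespace HasseDrawing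

variable {P : Type*} [PartialOrder P] (D : HasseDrawing P)

lemma height_lt (e : HasseEdge P) : (D.pos e.1.1).2 < (D.pos e.1.2).2 :=
  D.height_strictMono e.2.lt

lemma bot_le_height (v : PosetHat P) : (D.pos ⊥).2 ≤ (D.pos v).2 :=
  D.height_strictMono.monotone bot_le

lemma height_le_top (v : PosetHat P) : (D.pos v).2 ≤ (D.pos ⊤).2 :=
  D.height_strictMono.monotone le_top

/-- Take a maximal element of `[v, w]` of height at most `y`; any cover of it below `w` is already
higher than `y`. -/
lemma exists_edge_at [Finite P] {v w : PosetHat P} {y : ℝ} (hv : (D.pos v).2 ≤ y)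
    (hvw : v ≤ w) (hw : y < (D.pos w).2) :
    ∃ e : HasseEdge P, v ≤ e.1.1 ∧ e.1.2 ≤ w ∧ y ∈ Ico (D.pos e.1.1).2 (D.pos e.1.2).2 := by
  obtain ⟨a, ⟨hva, haw, hay⟩, hmax⟩ := (Set.toFinite
    {a : PosetHat P | v ≤ a ∧ a ≤ w ∧ (D.pos a).2 ≤ y}).exists_maximal ⟨v, le_rfl, hvw, hv⟩
  have hne : a < w := lt_of_le_of_ne haw (by rintro rfl; linarith)
  obtain ⟨b, hab, hbw⟩ := exists_covBy_le_of_lt hne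
  refine ⟨⟨(a, b), hab⟩, hva, hbw, hay, ?_⟩
  by_contra hlt
  exact absurd (hmax ⟨hva.trans hab.le, hbw, not_lt.1 hlt⟩ hab.le) (not_le_of_gt hab.lt)

lemma curve_ne_of_ne {e e' : HasseEdge P} {y : ℝ} (hne : e ≠ e')
    (hy : y ∈ Ioo (D.pos e.1.1).2 (D.pos e.1.2).2)
    (hy' : y ∈ Icc (D.pos e'.1.1).2 (D.pos e'.1.2).2) : D.curve e y ≠ D.curve e' y := by
  intro h
  obtain ⟨v, hv⟩ := D.curve_inter e e' y hne (Ioo_subset_Icc_self hy) hy' h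
  have h2 : (D.pos v).2 = y := by rw [hv]
  have h1 : (D.pos v).1 = D.curve e y := by rw [hv]
  have := D.vertex_on_curve e v (h2 ▸ Ioo_subset_Icc_self hy) (by rw [h2, h1])
  rcases this with rfl | rfl
  · exact hy.1.ne h2
  · exact hy.2.ne h2.symm

end HasseDrawing

/-! ### The augmented drawing as a curve system, and the region it encloses -/

namespace AugmentedDrawing

variable {P : Type*} [PartialOrder P] (D : AugmentedDrawing P)

lemma mem_Ioo_of_mem_Ioo {e : HasseEdge P} {y : ℝ}
    (hy : y ∈ Ioo (D.pos e.1.1).2 (D.pos e.1.2).2) : y ∈ Ioo (D.pos ⊥).2 (D.pos ⊤).2 :=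
  ⟨(D.bot_le_height _).trans_lt hy.1, hy.2.trans_le (D.height_le_top _)⟩

lemma bot_lt_top_height : (D.pos ⊥).2 < (D.pos ⊤).2 := D.height_strictMono bot_lt_top

variable [Finite P]

lemma left_lt_right {y : ℝ} (hy : y ∈ Ioo (D.pos ⊥).2 (D.pos ⊤).2) :
    D.leftCurve y < D.rightCurve y := by
  obtain ⟨e, -, -, he⟩ := D.exists_edge_at hy.1.le bot_le hy.2
  exact (D.left_lt y hy e (Ico_subset_Icc_self he)).trans
    (D.lt_right y hy e (Ico_subset_Icc_self he))

/-- The curves of the augmented drawing; the two additional edges are indexed by `Bool`. -/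
def curves : CurveSystem (HasseEdge P ⊕ Bool) where
  lo := Sum.elim (fun e => (D.pos e.1.1).2) fun _ => (D.pos ⊥).2
  hi := Sum.elim (fun e => (D.pos e.1.2).2) fun _ => (D.pos ⊤).2
  lo_lt_hi := by
    rintro (e | b)
    · exact D.height_lt e
    · exact D.bot_lt_top_height
  -- The curves of a drawing are continuous only on their height intervals; extending them by their
  -- end values makes them continuous on the line without changing the traces.
  curve := Sum.elim (fun e => IccExtend (D.height_lt e).le ((Icc _ _).domRestrict (D.curve e)))
    fun b => IccExtend D.bot_lt_top_height.le
      ((Icc _ _).domRestrict (bif b then D.rightCurve else D.leftCurve))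
  continuous_curve := by
    rintro (e | _ | _)
    · exact (D.curve_continuousOn e).domRestrict.Icc_extend'
    · exact D.left_continuousOn.domRestrict.Icc_extend'
    · exact D.right_continuousOn.domRestrict.Icc_extend'
  curve_ne := by
    rintro (e | b) (e' | b') y hne hy hy' h <;>
      simp only [Sum.elim_inl, Sum.elim_inr] at hy hy' h <;>
      rw [IccExtend_of_mem _ _ (Ioo_subset_Icc_self hy), IccExtend_of_mem _ _ hy'] at h <;>
      simp only [domRestrict_apply] at h
    · exact D.curve_ne_of_ne (fun h => hne (by rw [h])) hy hy' h
    · cases b'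
      · exact (D.left_lt y (D.mem_Ioo_of_mem_Ioo hy) e (Ioo_subset_Icc_self hy)).ne' h
      · exact (D.lt_right y (D.mem_Ioo_of_mem_Ioo hy) e (Ioo_subset_Icc_self hy)).ne h
    · cases b
      · exact (D.left_lt y hy e' hy').ne h
      · exact (D.lt_right y hy e' hy').ne' h
    · have := D.left_lt_right hy
      cases b <;> cases b' <;> simp at h hne <;> linarith

lemma curves_inl {e : HasseEdge P} {y : ℝ} (hy : y ∈ Icc (D.pos e.1.1).2 (D.pos e.1.2).2) :
    D.curves.curve (.inl e) y = D.curve e y :=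
  IccExtend_of_mem (D.height_lt e).le ((Icc _ _).domRestrict (D.curve e)) hy

lemma curves_left {y : ℝ} (hy : y ∈ Icc (D.pos ⊥).2 (D.pos ⊤).2) :
    D.curves.curve (.inr false) y = D.leftCurve y :=
  IccExtend_of_mem D.bot_lt_top_height.le ((Icc _ _).domRestrict (D.leftCurve)) hy

lemma curves_right {y : ℝ} (hy : y ∈ Icc (D.pos ⊥).2 (D.pos ⊤).2) :
    D.curves.curve (.inr true) y = D.rightCurve y :=
  IccExtend_of_mem D.bot_lt_top_height.le ((Icc _ _).domRestrict (D.rightCurve)) hy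

lemma curves_support : D.curves.support = D.support := by
  ext ⟨x, y⟩
  constructor
  · rintro ⟨e | _ | _, hy, hx⟩
    · exact Or.inl ⟨e, hy, hx.trans (D.curves_inl hy)⟩
    · exact Or.inr ⟨hy, Or.inl (hx.trans (D.curves_left hy))⟩
    · exact Or.inr ⟨hy, Or.inr (hx.trans (D.curves_right hy))⟩
  · rintro (⟨e, hy, hx⟩ | ⟨hy, hx | hx⟩)
    · exact ⟨.inl e, hy, hx.trans (D.curves_inl hy).symm⟩
    · exact ⟨.inr false, hy, hx.trans (D.curves_left hy).symm⟩
    · exact ⟨.inr true, hy, hx.trans (D.curves_right hy).symm⟩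

lemma mem_Icc_of_mem_Icc {e : HasseEdge P} {y : ℝ}
    (hy : y ∈ Icc (D.pos e.1.1).2 (D.pos e.1.2).2) : y ∈ Icc (D.pos ⊥).2 (D.pos ⊤).2 :=
  ⟨(D.bot_le_height _).trans hy.1, hy.2.trans (D.height_le_top _)⟩

/-- The open region between the two additional edges. -/
def region : Set (ℝ × ℝ) :=
  {z | z.2 ∈ Ioo (D.pos ⊥).2 (D.pos ⊤).2 ∧ D.curves.curve (.inr false) z.2 < z.1 ∧
    z.1 < D.curves.curve (.inr true) z.2}

lemma isOpen_region : IsOpen D.region := by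
  have h1 := D.curves.continuous_curve (.inr false)
  have h2 := D.curves.continuous_curve (.inr true)
  exact (isOpen_Ioo.preimage continuous_snd).inter
    ((isOpen_lt (h1.comp continuous_snd) continuous_fst).inter
      (isOpen_lt continuous_fst (h2.comp continuous_snd)))

def closedRegion : Set (ℝ × ℝ) :=
  {z | z.2 ∈ Icc (D.pos ⊥).2 (D.pos ⊤).2 ∧ D.curves.curve (.inr false) z.2 ≤ z.1 ∧
    z.1 ≤ D.curves.curve (.inr true) z.2}

lemma isClosed_closedRegion : IsClosed D.closedRegion := by
  have h1 := D.curves.continuous_curve (.inr false)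
  have h2 := D.curves.continuous_curve (.inr true)
  exact (isClosed_Icc.preimage continuous_snd).inter
    ((isClosed_le (h1.comp continuous_snd) continuous_fst).inter
      (isClosed_le continuous_fst (h2.comp continuous_snd)))

lemma region_subset_closedRegion : D.region ⊆ D.closedRegion := fun _ hz =>
  ⟨Ioo_subset_Icc_self hz.1, hz.2.1.le, hz.2.2.le⟩

/-- At the two extreme heights the additional edges meet, so there the closed region has only the
points `⊥` and `⊤`, which lie on the curves. -/
lemma mem_region_of_mem_closedRegion {z : ℝ × ℝ} (hz : z ∈ D.closedRegion)
    (hs : z ∉ D.curves.support) : z ∈ D.region := by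
  obtain ⟨hy, h1, h2⟩ := hz
  have h1' := lt_of_le_of_ne h1 (fun h => hs ⟨.inr false, hy, h.symm⟩)
  have h2' := lt_of_le_of_ne h2 (fun h => hs ⟨.inr true, hy, h⟩)
  refine ⟨⟨lt_of_le_of_ne hy.1 ?_, lt_of_le_of_ne hy.2 ?_⟩, h1', h2'⟩ <;> intro h
  · rw [D.curves_left hy, ← h, D.left_bot] at h1'
    rw [D.curves_right hy, ← h, D.right_bot] at h2'
    exact lt_asymm h1' h2'
  · rw [D.curves_left hy, h, D.left_top] at h1'
    rw [D.curves_right hy, h, D.right_top] at h2'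
    exact lt_asymm h1' h2'

lemma support_subset_closedRegion : D.curves.support ⊆ D.closedRegion := by
  rintro ⟨x, y⟩ hz
  rw [D.curves_support] at hz
  have hy : y ∈ Icc (D.pos ⊥).2 (D.pos ⊤).2 := by
    rcases hz with ⟨e, hy, -⟩ | ⟨hy, -⟩
    · exact D.mem_Icc_of_mem_Icc hy
    · exact hy
  have hlr : D.leftCurve y ≤ D.rightCurve y := by
    rcases hy.1.eq_or_lt with h | h
    · rw [← h, D.left_bot, D.right_bot]
    rcases hy.2.eq_or_lt with h' | h'
    · rw [h', D.left_top, D.right_top]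
    exact (D.left_lt_right ⟨h, h'⟩).le
  refine ⟨hy, ?_⟩
  rw [D.curves_left hy, D.curves_right hy]
  simp only
  rcases hz with ⟨e, hye, hx⟩ | ⟨-, hx | hx⟩ <;> simp only at hx
  · simp only at hye
    rcases hy.1.eq_or_lt with h | h
    · have : e.1.1 = ⊥ := by
        by_contra hne
        have := D.height_strictMono (bot_lt_iff_ne_bot.2 hne)
        simp only at this
        linarith [hye.1]
      have h2 : D.curve e y = (D.pos ⊥).1 := by
        rw [← this, ← D.curve_lower e, this, h]
      rw [hx, h2, ← h, D.left_bot, D.right_bot]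
      exact ⟨le_rfl, le_rfl⟩
    rcases hy.2.eq_or_lt with h' | h'
    · have : e.1.2 = ⊤ := by
        by_contra hne
        have := D.height_strictMono (lt_top_iff_ne_top.2 hne)
        simp only at this
        linarith [hye.2]
      have h2 : D.curve e y = (D.pos ⊤).1 := by
        rw [← this, ← D.curve_upper e, this, h']
      rw [hx, h2, h', D.left_top, D.right_top]
      exact ⟨le_rfl, le_rfl⟩
    rw [hx]
    exact ⟨(D.left_lt y ⟨h, h'⟩ e hye).le, (D.lt_right y ⟨h, h'⟩ e hye).le⟩
  · exact ⟨hx.ge, hx.le.trans hlr⟩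
  · exact ⟨hlr.trans hx.ge, hx.le⟩

lemma isBounded_region : Bornology.IsBounded D.region := by
  have hL := (isCompact_Icc (a := (D.pos ⊥).2) (b := (D.pos ⊤).2)).image
    (D.curves.continuous_curve (.inr false))
  have hR := (isCompact_Icc (a := (D.pos ⊥).2) (b := (D.pos ⊤).2)).image
    (D.curves.continuous_curve (.inr true))
  obtain ⟨a, ha⟩ := hL.bddBelow
  obtain ⟨b, hb⟩ := hR.bddAbove
  refine ((Metric.isBounded_Icc a b).prod (Metric.isBounded_Icc (D.pos ⊥).2 (D.pos ⊤).2)).subset ?_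
  rintro ⟨x, y⟩ ⟨hy, h1, h2⟩
  have hy' := Ioo_subset_Icc_self hy
  exact ⟨⟨(ha ⟨y, hy', rfl⟩).trans h1.le, h2.le.trans (hb ⟨y, hy', rfl⟩)⟩, hy'⟩

/-- Off the curves, the open region and the complement of the closed one are disjoint open sets
covering everything, so a connected set stays in one of them. -/
lemma component_subset_region {z : ℝ × ℝ} (hz : z ∉ D.curves.support) (hR : z ∈ D.region) :
    D.curves.component z ⊆ D.region := by
  have hpre : IsPreconnected (D.curves.component z) := isPreconnected_connectedComponentIn
  have hsub : D.curves.component z ⊆ D.curves.supportᶜ := connectedComponentIn_subset _ _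
  refine hpre.subset_left_of_subset_union D.isOpen_region D.isClosed_closedRegion.isOpen_compl
    (disjoint_compl_right_iff_subset.2 D.region_subset_closedRegion) ?_
    ⟨z, mem_connectedComponentIn hz, hR⟩
  intro w hw
  by_cases h : w ∈ D.closedRegion
  · exact Or.inl (D.mem_region_of_mem_closedRegion h (hsub hw))
  · exact Or.inr h

lemma isBounded_component {z : ℝ × ℝ} (hz : z ∉ D.curves.support) (hR : z ∈ D.region) :
    Bornology.IsBounded (D.curves.component z) :=
  D.isBounded_region.subset (D.component_subset_region hz hR)

lemma mem_region_of_isBounded {z : ℝ × ℝ} (hz : z ∉ D.curves.support)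
    (hb : Bornology.IsBounded (D.curves.component z)) : z ∈ D.region := by
  by_contra hR
  have hcl : z ∉ D.closedRegion := fun h => hR (D.mem_region_of_mem_closedRegion h hz)
  obtain ⟨x, y⟩ := z
  obtain ⟨r, hr⟩ := hb.subset_closedBall (x, y)
  -- A point outside the closed region can escape to infinity along a horizontal ray, so its
  -- component is unbounded.
  have key : (∀ t ≥ 0, (x - t, y) ∉ D.curves.support) ∨ ∀ t ≥ 0, (x + t, y) ∉ D.curves.support := by
    by_cases hy : y ∈ Icc (D.pos ⊥).2 (D.pos ⊤).2
    · by_cases hx : D.curves.curve (.inr false) y ≤ x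
      · right
        intro t ht hs
        have := (D.support_subset_closedRegion hs).2.2
        simp only at this
        exact hcl ⟨hy, hx, by simp only; linarith⟩
      · left
        intro t ht hs
        have := (D.support_subset_closedRegion hs).2.1
        simp only at this
        exact hx (by linarith)
    · exact Or.inl fun t _ hs => hy (D.support_subset_closedRegion hs).1
  set s : ℝ := |r| + 1 with hs
  have hspos : 0 < s := by positivity
  have hrs : r < s := by linarith [le_abs_self r]
  rcases key with h | h
  · have hseg := D.curves.component_eq_of_segment (y := y) (x₁ := x - s) (x₂ := x) (by linarith)
      fun w hw => by simpa using h (x - w) (by linarith [hw.2])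
    have hm : (x - s, y) ∈ D.curves.component (x, y) := by
      rw [← hseg]
      exact mem_connectedComponentIn (h s hspos.le)
    have := hr hm
    rw [Metric.mem_closedBall, Prod.dist_eq, Real.dist_eq] at this
    have h2 := (le_max_left _ _).trans this
    simp only at h2
    rw [sub_sub_cancel_left, abs_neg, abs_of_pos hspos] at h2
    linarith
  · have hseg := D.curves.component_eq_of_segment (y := y) (x₁ := x) (x₂ := x + s) (by linarith)
      fun w hw => by simpa using h (w - x) (by linarith [hw.1])
    have hm : (x + s, y) ∈ D.curves.component (x, y) := by
      rw [hseg]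
      exact mem_connectedComponentIn (h s hspos.le)
    have := hr hm
    rw [Metric.mem_closedBall, Prod.dist_eq, Real.dist_eq] at this
    have h2 := (le_max_left _ _).trans this
    simp only at h2
    rw [add_sub_cancel_left, abs_of_pos hspos] at h2
    linarith

/-- The bounded face of a point of the region between the two additional edges. -/
def faceOf (z : ℝ × ℝ) (hz : z ∉ D.curves.support) (hR : z ∈ D.region) : D.BoundedFace :=
  ⟨D.curves.component z, ⟨z, by rwa [← D.curves_support], by
    rw [← D.curves_support]; rfl⟩, D.isBounded_component hz hR⟩

lemma exists_eq_faceOf (F : D.BoundedFace) : ∃ z hz hR, F = D.faceOf z hz hR := by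
  obtain ⟨F, ⟨z, hz, rfl⟩, hb⟩ := F
  rw [← D.curves_support] at hz
  have hb' : Bornology.IsBounded (D.curves.component z) := by
    unfold CurveSystem.component
    rwa [D.curves_support]
  refine ⟨z, hz, D.mem_region_of_isBounded hz hb', ?_⟩
  apply Subtype.ext
  simp only [faceOf, CurveSystem.component, D.curves_support]

lemma eventually_mem_region {e : HasseEdge P} {y : ℝ}
    (hy : y ∈ Ioo (D.pos e.1.1).2 (D.pos e.1.2).2) :
    ∀ᶠ x in 𝓝 (D.curve e y), (x, y) ∈ D.region := by
  have hy' := D.mem_Ioo_of_mem_Ioo hy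
  have h1 := D.left_lt y hy' e (Ioo_subset_Icc_self hy)
  have h2 := D.lt_right y hy' e (Ioo_subset_Icc_self hy)
  filter_upwards [Ioo_mem_nhds h1 h2] with x hx
  refine ⟨hy', ?_⟩
  rw [D.curves_left (Ioo_subset_Icc_self hy'), D.curves_right (Ioo_subset_Icc_self hy')]
  exact hx

end AugmentedDrawing

/-! ### The bounded faces along the edges -/

namespace AugmentedDrawing

variable {P : Type*} [PartialOrder P] [Finite P] (D : AugmentedDrawing P)

lemma mid_mem (e : HasseEdge P) :
    ((D.pos e.1.1).2 + (D.pos e.1.2).2) / 2 ∈ Ioo (D.pos e.1.1).2 (D.pos e.1.2).2 := by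
  have := D.height_lt e
  constructor <;> linarith

lemma eventually_left (e : HasseEdge P) {y : ℝ} (hy : y ∈ Ioo (D.pos e.1.1).2 (D.pos e.1.2).2) :
    ∀ᶠ x in 𝓝[<] (D.curve e y), (x, y) ∉ D.curves.support ∧
      D.curves.component (x, y) = D.curves.leftFace (.inl e) := by
  have := D.curves.eventually_leftFace (.inl e) hy
  rwa [D.curves_inl (Ioo_subset_Icc_self hy)] at this

lemma eventually_right (e : HasseEdge P) {y : ℝ} (hy : y ∈ Ioo (D.pos e.1.1).2 (D.pos e.1.2).2) :
    ∀ᶠ x in 𝓝[>] (D.curve e y), (x, y) ∉ D.curves.support ∧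
      D.curves.component (x, y) = D.curves.rightFace (.inl e) := by
  have := D.curves.eventually_rightFace (.inl e) hy
  rwa [D.curves_inl (Ioo_subset_Icc_self hy)] at this

lemma exists_faceOf_left (e : HasseEdge P) :
    ∃ z hz hR, (D.faceOf z hz hR).1 = D.curves.leftFace (.inl e) := by
  obtain ⟨x, ⟨hx, hx'⟩, hR⟩ := ((D.eventually_left e (D.mid_mem e)).and
    (nhdsWithin_le_nhds (D.eventually_mem_region (D.mid_mem e)))).exists
  exact ⟨_, hx, hR, hx'⟩

lemma exists_faceOf_right (e : HasseEdge P) :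
    ∃ z hz hR, (D.faceOf z hz hR).1 = D.curves.rightFace (.inl e) := by
  obtain ⟨x, ⟨hx, hx'⟩, hR⟩ := ((D.eventually_right e (D.mid_mem e)).and
    (nhdsWithin_le_nhds (D.eventually_mem_region (D.mid_mem e)))).exists
  exact ⟨_, hx, hR, hx'⟩

/-- The bounded face on the left of an edge. -/
def leftFace (e : HasseEdge P) : D.BoundedFace :=
  ⟨D.curves.leftFace (.inl e), by
    obtain ⟨z, hz, hR, h⟩ := D.exists_faceOf_left e
    exact h ▸ (D.faceOf z hz hR).2⟩

/-- The bounded face on the right of an edge. -/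
def rightFace (e : HasseEdge P) : D.BoundedFace :=
  ⟨D.curves.rightFace (.inl e), by
    obtain ⟨z, hz, hR, h⟩ := D.exists_faceOf_right e
    exact h ▸ (D.faceOf z hz hR).2⟩

lemma eventually_source {y : ℝ} (hy : y ∈ Ioo (D.pos ⊥).2 (D.pos ⊤).2) :
    ∀ᶠ x in 𝓝[>] (D.leftCurve y), ((x, y) ∉ D.curves.support ∧
      D.curves.component (x, y) = D.curves.rightFace (.inr false)) ∧ (x, y) ∈ D.region := by
  have h := D.curves.eventually_rightFace (.inr false) hy
  rw [D.curves_left (Ioo_subset_Icc_self hy)] at h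
  refine h.and ?_
  filter_upwards [Ioo_mem_nhdsGT (D.left_lt_right hy)] with x hx
  refine ⟨hy, ?_⟩
  rwa [D.curves_left (Ioo_subset_Icc_self hy), D.curves_right (Ioo_subset_Icc_self hy)]

lemma eventually_sink {y : ℝ} (hy : y ∈ Ioo (D.pos ⊥).2 (D.pos ⊤).2) :
    ∀ᶠ x in 𝓝[<] (D.rightCurve y), ((x, y) ∉ D.curves.support ∧
      D.curves.component (x, y) = D.curves.leftFace (.inr true)) ∧ (x, y) ∈ D.region := by
  have h := D.curves.eventually_leftFace (.inr true) hy
  rw [D.curves_right (Ioo_subset_Icc_self hy)] at h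
  refine h.and ?_
  filter_upwards [Ioo_mem_nhdsLT (D.left_lt_right hy)] with x hx
  refine ⟨hy, ?_⟩
  rwa [D.curves_left (Ioo_subset_Icc_self hy), D.curves_right (Ioo_subset_Icc_self hy)]

lemma exists_height : ∃ y, y ∈ Ioo (D.pos ⊥).2 (D.pos ⊤).2 := exists_between D.bot_lt_top_height

/-- The bounded face along the left additional edge. -/
def sourceFace : D.BoundedFace :=
  ⟨D.curves.rightFace (.inr false), by
    obtain ⟨y, hy⟩ := D.exists_height
    obtain ⟨x, ⟨hx, hx'⟩, hR⟩ := (D.eventually_source hy).exists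
    exact hx' ▸ (D.faceOf (x, y) hx hR).2⟩

/-- The bounded face along the right additional edge. -/
def sinkFace : D.BoundedFace :=
  ⟨D.curves.leftFace (.inr true), by
    obtain ⟨y, hy⟩ := D.exists_height
    obtain ⟨x, ⟨hx, hx'⟩, hR⟩ := (D.eventually_sink hy).exists
    exact hx' ▸ (D.faceOf (x, y) hx hR).2⟩

lemma isLeftFace_leftFace (e : HasseEdge P) : D.IsLeftFace (D.leftFace e).1 e := by
  intro y hy
  filter_upwards [D.eventually_left e hy] with x hx
  change (x, y) ∈ D.curves.leftFace (.inl e)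
  rw [← hx.2]
  exact mem_connectedComponentIn hx.1

lemma isRightFace_rightFace (e : HasseEdge P) : D.IsRightFace (D.rightFace e).1 e := by
  intro y hy
  filter_upwards [D.eventually_right e hy] with x hx
  change (x, y) ∈ D.curves.rightFace (.inl e)
  rw [← hx.2]
  exact mem_connectedComponentIn hx.1

lemma eq_component_of_mem (F : D.BoundedFace) {z : ℝ × ℝ} (hz : z ∈ F.1) :
    F.1 = D.curves.component z := by
  obtain ⟨w, hw, hR, rfl⟩ := D.exists_eq_faceOf F
  exact connectedComponentIn_eq hz

lemma eq_of_mem {F F' : D.BoundedFace} {z : ℝ × ℝ} (hz : z ∈ F.1) (hz' : z ∈ F'.1) : F = F' :=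
  Subtype.ext ((D.eq_component_of_mem F hz).trans (D.eq_component_of_mem F' hz').symm)

/-- Distinct faces are disjoint, so a common point next to the middle of the edge suffices. This
identifies the faces that `IsTruncatedDual` describes only through `IsLeftFace`. -/
lemma eq_leftFace {F : D.BoundedFace} {e : HasseEdge P} (h : D.IsLeftFace F.1 e) :
    F = D.leftFace e := by
  obtain ⟨x, hx, hx'⟩ := ((h _ (D.mid_mem e)).and
    (D.isLeftFace_leftFace e _ (D.mid_mem e))).exists
  exact D.eq_of_mem hx hx'

lemma eq_rightFace {F : D.BoundedFace} {e : HasseEdge P} (h : D.IsRightFace F.1 e) :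
    F = D.rightFace e := by
  obtain ⟨x, hx, hx'⟩ := ((h _ (D.mid_mem e)).and
    (D.isRightFace_rightFace e _ (D.mid_mem e))).exists
  exact D.eq_of_mem hx hx'

lemma mem_region_of_mem (F : D.BoundedFace) {z : ℝ × ℝ} (hz : z ∈ F.1) : z ∈ D.region := by
  obtain ⟨w, hw, hR, rfl⟩ := D.exists_eq_faceOf F
  exact D.component_subset_region hw hR hz

lemma not_mem_support_of_mem (F : D.BoundedFace) {z : ℝ × ℝ} (hz : z ∈ F.1) :
    z ∉ D.curves.support := by
  obtain ⟨w, hw, hR, rfl⟩ := D.exists_eq_faceOf F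
  exact connectedComponentIn_subset _ _ hz

/-- A bounded face contains points at a height that is not the height of a vertex. -/
lemma exists_mem_generic (F : D.BoundedFace) :
    ∃ x y, (x, y) ∈ F.1 ∧ ∀ v, (D.pos v).2 ≠ y := by
  obtain ⟨⟨x, y₀⟩, hz, hR, rfl⟩ := D.exists_eq_faceOf F
  have hopen : IsOpen (D.curves.component (x, y₀)) :=
    D.curves.isClosed_support.isOpen_compl.connectedComponentIn
  have h1 : ∀ᶠ y in 𝓝[>] y₀, (x, y) ∈ D.curves.component (x, y₀) := by
    have hc : Continuous fun y : ℝ => (x, y) := by fun_prop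
    exact nhdsWithin_le_nhds (hc.continuousAt.eventually
      (hopen.mem_nhds (mem_connectedComponentIn hz)))
  have h2 : ∀ᶠ y in 𝓝[>] y₀, ∀ v, (D.pos v).2 ≠ y := by
    rw [Filter.eventually_all]
    intro v
    by_cases h : (D.pos v).2 = y₀
    · filter_upwards [self_mem_nhdsWithin] with y hy
      rw [h]
      exact (ne_of_lt hy)
    · filter_upwards [nhdsWithin_le_nhds (isOpen_ne.mem_nhds (Ne.symm h))] with y hy
      exact Ne.symm hy
  obtain ⟨y, hy1, hy2⟩ := (h1.and h2).exists
  exact ⟨x, y, hy1, hy2⟩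

lemma mem_Ioo_of_generic {y : ℝ} (hy : ∀ v, (D.pos v).2 ≠ y) (i : HasseEdge P ⊕ Bool)
    (hi : y ∈ Icc (D.curves.lo i) (D.curves.hi i)) :
    y ∈ Ioo (D.curves.lo i) (D.curves.hi i) := by
  rcases i with e | b
  · exact ⟨lt_of_le_of_ne hi.1 (hy e.1.1), lt_of_le_of_ne hi.2 (hy e.1.2).symm⟩
  · exact ⟨lt_of_le_of_ne hi.1 (hy ⊥), lt_of_le_of_ne hi.2 (hy ⊤).symm⟩

/-- The nearest curve to the left of a generic point of the face is a Hasse edge or the left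
additional edge. Dually: the source is the only vertex that can lack an incoming edge. -/
lemma exists_rightFace_eq {F : D.BoundedFace} (hF : F ≠ D.sourceFace) :
    ∃ e, D.rightFace e = F := by
  obtain ⟨x, y, hm, hy⟩ := D.exists_mem_generic F
  have hR := D.mem_region_of_mem F hm
  obtain ⟨i, hi, hix, h⟩ := D.curves.exists_component_eq_rightFace
    (D.not_mem_support_of_mem F hm) (D.mem_Ioo_of_generic hy)
    ⟨.inr false, Ioo_subset_Icc_self hR.1, hR.2.1⟩
  rw [← D.eq_component_of_mem F hm] at h
  rcases i with e | _ | _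
  · exact ⟨e, (Subtype.ext h).symm⟩
  · exact absurd (Subtype.ext h) hF
  · exact absurd hix hR.2.2.not_gt

lemma exists_leftFace_eq {F : D.BoundedFace} (hF : F ≠ D.sinkFace) :
    ∃ e, D.leftFace e = F := by
  obtain ⟨x, y, hm, hy⟩ := D.exists_mem_generic F
  have hR := D.mem_region_of_mem F hm
  obtain ⟨i, hi, hix, h⟩ := D.curves.exists_component_eq_leftFace
    (D.not_mem_support_of_mem F hm) (D.mem_Ioo_of_generic hy)
    ⟨.inr true, Ioo_subset_Icc_self hR.1, hR.2.2⟩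
  rw [← D.eq_component_of_mem F hm] at h
  rcases i with e | _ | _
  · exact ⟨e, (Subtype.ext h).symm⟩
  · exact absurd hix hR.2.1.not_gt
  · exact absurd (Subtype.ext h) hF

instance instFiniteBoundedFace : Finite D.BoundedFace := by
  have : range (fun o : Option (HasseEdge P) => o.elim D.sourceFace D.rightFace) = univ := by
    rw [eq_univ_iff_forall]
    intro F
    by_cases hF : F = D.sourceFace
    · exact ⟨none, hF.symm⟩
    · obtain ⟨e, he⟩ := D.exists_rightFace_eq hF
      exact ⟨some e, he⟩
  exact Finite.of_surjective _ (range_eq_univ.1 this)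

/-! ### Jumps -/

/-- The jump lemmas for curve systems take functions of arbitrary sets, because components there may
be unbounded. -/
lemma exists_extend (g : D.BoundedFace → ℝ) : ∃ g' : Set (ℝ × ℝ) → ℝ, ∀ F, g' F.1 = g F := by
  classical
  exact ⟨fun s => if h : ∃ F : D.BoundedFace, F.1 = s then g h.choose else 0, fun F => by
    have h : ∃ F' : D.BoundedFace, F'.1 = F.1 := ⟨F, rfl⟩
    simp only [dif_pos h]
    rw [Subtype.ext h.choose_spec]⟩

open Classical in
/-- The jumps of a function of the faces across the edges below and above an inner vertex have the
same sum. -/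
lemma sum_jump_inner (g : D.BoundedFace → ℝ) {v : PosetHat P} (hb : v ≠ ⊥) (ht : v ≠ ⊤) :
    ∑ e with e.1.2 = v, (g (D.rightFace e) - g (D.leftFace e)) =
      ∑ e with e.1.1 = v, (g (D.rightFace e) - g (D.leftFace e)) := by
  obtain ⟨g', hg'⟩ := D.exists_extend g
  have hhb := D.height_strictMono (bot_lt_iff_ne_bot.2 hb)
  have hht := D.height_strictMono (lt_top_iff_ne_top.2 ht)
  simp only at hhb hht
  have key := D.curves.sum_jump_vertex g' (D.pos v)
    ((Finset.univ.filter fun e : HasseEdge P => e.1.2 = v).map ⟨Sum.inl, Sum.inl_injective⟩)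
    ((Finset.univ.filter fun e : HasseEdge P => e.1.1 = v).map ⟨Sum.inl, Sum.inl_injective⟩)
    ?_ ?_ ?_
  · rw [Finset.sum_map, Finset.sum_map] at key
    simp only [Function.Embedding.coeFn_mk] at key
    simp only [← hg']
    exact key
  · rintro (e | b)
    · simp only [Finset.mem_map, Finset.mem_filter, Finset.mem_univ, true_and,
        Function.Embedding.coeFn_mk, Sum.inl.injEq, exists_eq_right]
      constructor
      · rintro rfl
        refine ⟨rfl, ?_⟩
        rw [D.curves_inl ⟨(D.height_lt e).le, le_rfl⟩, D.curve_upper]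
      · rintro ⟨h1, h2⟩
        change (D.pos e.1.2).2 = _ at h1
        rw [D.curves_inl ⟨h1 ▸ (D.height_lt e).le, h1.ge⟩, ← h1, D.curve_upper] at h2
        exact D.pos_injective (Prod.ext h2 h1)
    · simp only [Finset.mem_map, Function.Embedding.coeFn_mk, reduceCtorEq, and_false,
        exists_false, false_iff, not_and]
      intro h
      exact absurd h hht.ne'
  · rintro (e | b)
    · simp only [Finset.mem_map, Finset.mem_filter, Finset.mem_univ, true_and,
        Function.Embedding.coeFn_mk, Sum.inl.injEq, exists_eq_right]
      constructor
      · rintro rfl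
        refine ⟨rfl, ?_⟩
        rw [D.curves_inl ⟨le_rfl, (D.height_lt e).le⟩, D.curve_lower]
      · rintro ⟨h1, h2⟩
        change (D.pos e.1.1).2 = _ at h1
        rw [D.curves_inl ⟨h1.le, h1 ▸ (D.height_lt e).le⟩, ← h1, D.curve_lower] at h2
        exact D.pos_injective (Prod.ext h2 h1)
    · simp only [Finset.mem_map, Function.Embedding.coeFn_mk, reduceCtorEq, and_false,
        exists_false, false_iff, not_and]
      intro h
      exact absurd h hhb.ne
  · rintro (e | b) ⟨h1, h2⟩
    · rw [D.curves_inl h1] at h2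
      rcases D.vertex_on_curve e v h1 h2.symm with rfl | rfl
      · exact Or.inr rfl
      · exact Or.inl rfl
    -- An inner vertex is the lower end of some Hasse edge, which runs strictly between the
    -- additional edges; so neither of these passes through it.
    · exfalso
      obtain ⟨w, hw, -⟩ := exists_covBy_le_of_lt (lt_top_iff_ne_top.2 ht)
      let e : HasseEdge P := ⟨(v, w), hw⟩
      have hv : (D.pos v).2 ∈ Icc (D.pos e.1.1).2 (D.pos e.1.2).2 := ⟨le_rfl, (D.height_lt e).le⟩
      have h3 := D.left_lt _ ⟨hhb, hht⟩ e hv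
      have h4 := D.lt_right _ ⟨hhb, hht⟩ e hv
      have h5 : D.curve e (D.pos v).2 = (D.pos v).1 := D.curve_lower e
      cases b
      · rw [D.curves_left h1] at h2
        linarith
      · rw [D.curves_right h1] at h2
        linarith

lemma bot_lt_height {v : PosetHat P} (hv : v ≠ ⊥) : (D.pos ⊥).2 < (D.pos v).2 :=
  D.height_strictMono (bot_lt_iff_ne_bot.2 hv)

-- A horizontal cut above `⊥` and below all other vertices meets exactly the Hasse edges leaving
-- `⊥`, and leads from the source face to the sink face.
open Classical in
lemma sum_jump_bot (g : D.BoundedFace → ℝ) :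
    ∑ e with e.1.1 = ⊥, (g (D.rightFace e) - g (D.leftFace e)) =
      g D.sinkFace - g D.sourceFace := by
  obtain ⟨g', hg'⟩ := D.exists_extend g
  obtain ⟨y, hy, hyI⟩ : ∃ y, (∀ v ≠ ⊥, y < (D.pos v).2) ∧ (D.pos ⊥).2 < y := by
    have : ∀ᶠ y in 𝓝[>] (D.pos ⊥).2, ∀ v ≠ ⊥, y < (D.pos v).2 := by
      rw [Filter.eventually_all]
      intro v
      by_cases h : v = ⊥
      · simp [h]
      · filter_upwards [Ioo_mem_nhdsGT (D.bot_lt_height h)] with y hy _ using hy.2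
    exact (this.and self_mem_nhdsWithin).exists
  have hyI' : y ∈ Ioo (D.pos ⊥).2 (D.pos ⊤).2 := ⟨hyI, hy ⊤ bot_ne_top.symm⟩
  have hyIcc := Ioo_subset_Icc_self hyI'
  have halive : ∀ e : HasseEdge P, e.1.1 = ⊥ ↔ y ∈ Icc (D.pos e.1.1).2 (D.pos e.1.2).2 := by
    intro e
    constructor
    · intro h
      exact ⟨h ▸ hyI.le, (hy _ (h ▸ e.2.lt).ne_bot).le⟩
    · intro h
      by_contra hne
      exact absurd (hy _ hne) h.1.not_gt
  have hI : ∀ e : HasseEdge P, e.1.1 = ⊥ → y ∈ Ioo (D.pos e.1.1).2 (D.pos e.1.2).2 := fun e h =>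
    ⟨h ▸ hyI, hy _ (h ▸ e.2.lt).ne_bot⟩
  have hl : ∀ᶠ x in 𝓝[>] (D.leftCurve y), ∀ e : HasseEdge P, e.1.1 = ⊥ → x < D.curve e y := by
    rw [Filter.eventually_all]
    intro e
    by_cases h : e.1.1 = ⊥
    · filter_upwards [Ioo_mem_nhdsGT (D.left_lt y hyI' e ((halive e).1 h))] with x hx _ using hx.2
    · simp [h]
  have hr : ∀ᶠ x in 𝓝[<] (D.rightCurve y), ∀ e : HasseEdge P, e.1.1 = ⊥ → D.curve e y < x := by
    rw [Filter.eventually_all]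
    intro e
    by_cases h : e.1.1 = ⊥
    · filter_upwards [Ioo_mem_nhdsLT (D.lt_right y hyI' e ((halive e).1 h))] with x hx _ using hx.1
    · simp [h]
  obtain ⟨a, ⟨⟨ha1, ha2⟩, ha3⟩, ha4⟩ := ((D.eventually_source hyI').and hl).exists
  obtain ⟨b, ⟨⟨hb1, hb2⟩, hb3⟩, hb4⟩ := ((D.eventually_sink hyI').and hr).exists
  obtain ⟨e₀, -, -, he₀⟩ := D.exists_edge_at hyI.le bot_le hyI'.2
  have he₀' := (halive e₀).2 (Ico_subset_Icc_self he₀)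
  have key := D.curves.sum_jump_segment g' hb1
    ((Finset.univ.filter fun e : HasseEdge P => e.1.1 = ⊥).map ⟨Sum.inl, Sum.inl_injective⟩)
    ((ha4 e₀ he₀').trans (hb4 e₀ he₀')) ha1 ?_ ?_
  · rw [Finset.sum_map, ha2, hb2] at key
    simp only [Function.Embedding.coeFn_mk] at key
    simp only [← hg']
    exact key
  · rintro (e | b)
    · simp only [Finset.mem_map, Finset.mem_filter, Finset.mem_univ, true_and,
        Function.Embedding.coeFn_mk, Sum.inl.injEq, exists_eq_right]
      constructor
      · intro h
        have := (halive e).1 h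
        refine ⟨this, ?_⟩
        rw [D.curves_inl this]
        exact ⟨ha4 e h, hb4 e h⟩
      · rintro ⟨h, -⟩
        exact (halive e).2 h
    · simp only [Finset.mem_map, Function.Embedding.coeFn_mk, reduceCtorEq, and_false,
        exists_false, false_iff, not_and]
      rintro - ⟨h1, h2⟩
      cases b
      · exact lt_asymm ha3.2.1 h1
      · exact lt_asymm hb3.2.2 h2
  · intro i hi
    obtain ⟨e, he, rfl⟩ := Finset.mem_map.1 hi
    exact hI e (by simpa using he)

/-- Summation by parts for the pairing of differences along edges with jumps across edges. -/
theorem sum_diff_mul_jump (f : PosetHat P → ℝ) (g : D.BoundedFace → ℝ) :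
    ∑ e : HasseEdge P, (f e.1.2 - f e.1.1) * (g (D.rightFace e) - g (D.leftFace e)) =
      (f ⊤ - f ⊥) * (g D.sinkFace - g D.sourceFace) := by
  classical
  have : Fintype (PosetHat P) := Fintype.ofFinite _
  set J : HasseEdge P → ℝ := fun e => g (D.rightFace e) - g (D.leftFace e) with hJ
  set I : PosetHat P → ℝ := fun v => ∑ e with e.1.2 = v, J e with hI
  set O : PosetHat P → ℝ := fun v => ∑ e with e.1.1 = v, J e with hO
  have hbot : I ⊥ = 0 := Finset.sum_eq_zero fun e he =>
    absurd (Finset.mem_filter.1 he).2 e.2.lt.ne_bot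
  have htop : O ⊤ = 0 := Finset.sum_eq_zero fun e he =>
    absurd (Finset.mem_filter.1 he).2 e.2.lt.ne_top
  have hinner : ∀ v, v ≠ ⊥ → v ≠ ⊤ → I v - O v = 0 := fun v hb ht =>
    sub_eq_zero.2 (D.sum_jump_inner g hb ht)
  -- Collect the terms by vertices: inner vertices cancel, nothing enters `⊥` and nothing leaves
  -- `⊤`.
  have key : ∀ f : PosetHat P → ℝ, ∑ e, (f e.1.2 - f e.1.1) * J e = f ⊤ * I ⊤ - f ⊥ * O ⊥ := by
    intro f
    have h1 : ∑ e, f e.1.2 * J e = ∑ v, f v * I v := by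
      rw [← Finset.sum_fiberwise Finset.univ (fun e : HasseEdge P => e.1.2)]
      refine Finset.sum_congr rfl fun v _ => ?_
      rw [Finset.mul_sum]
      exact Finset.sum_congr rfl fun e he => by rw [(Finset.mem_filter.1 he).2]
    have h2 : ∑ e, f e.1.1 * J e = ∑ v, f v * O v := by
      rw [← Finset.sum_fiberwise Finset.univ (fun e : HasseEdge P => e.1.1)]
      refine Finset.sum_congr rfl fun v _ => ?_
      rw [Finset.mul_sum]
      exact Finset.sum_congr rfl fun e he => by rw [(Finset.mem_filter.1 he).2]
    simp only [sub_mul]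
    rw [Finset.sum_sub_distrib, h1, h2, ← Finset.sum_sub_distrib,
      Finset.sum_eq_add (⊤ : PosetHat P) ⊥ bot_ne_top.symm, hbot, htop]
    · ring
    · rintro v - ⟨ht, hb⟩
      rw [← mul_sub, hinner v hb ht, mul_zero]
    · simp
    · simp
  -- A constant `f` gives `I ⊤ = O ⊥`, so no second cut below `⊤` is needed.
  have h1 := key fun _ => 1
  simp only [sub_self, zero_mul, Finset.sum_const_zero, one_mul] at h1
  have h2 : O ⊥ = g D.sinkFace - g D.sourceFace := D.sum_jump_bot g
  rw [key f, ← h2]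
  linear_combination (-f ⊤) * h1

/-! ### Maximal chains -/

/-- The edges in `S` form a saturated chain from `a` to `b`, drawn along the curve `γ`. -/
structure IsChainCurve (a b : PosetHat P) (S : Finset (HasseEdge P)) (γ : ℝ → ℝ) : Prop where
  le : a ≤ b
  continuous : Continuous γ
  lower : γ (D.pos a).2 = (D.pos a).1
  upper : γ (D.pos b).2 = (D.pos b).1
  mem : ∀ e ∈ S, a ≤ e.1.1 ∧ e.1.2 ≤ b ∧
    ∀ y ∈ Icc (D.pos e.1.1).2 (D.pos e.1.2).2, γ y = D.curve e y
  cover : ∀ y ∈ Ico (D.pos a).2 (D.pos b).2,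
    ∃ e ∈ S, y ∈ Ico (D.pos e.1.1).2 (D.pos e.1.2).2

variable {D}

lemma IsChainCurve.refl (a : PosetHat P) : D.IsChainCurve a a ∅ fun _ => (D.pos a).1 :=
  ⟨le_rfl, continuous_const, rfl, rfl, by simp, by simp⟩

lemma IsChainCurve.edge (e : HasseEdge P) :
    D.IsChainCurve e.1.1 e.1.2 {e} (D.curves.curve (.inl e)) where
  le := e.2.le
  continuous := D.curves.continuous_curve _
  lower := by rw [D.curves_inl ⟨le_rfl, (D.height_lt e).le⟩, D.curve_lower]
  upper := by rw [D.curves_inl ⟨(D.height_lt e).le, le_rfl⟩, D.curve_upper]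
  mem := by
    simp only [Finset.mem_singleton, forall_eq, le_refl, true_and]
    exact fun y hy => D.curves_inl hy
  cover := fun y hy => ⟨e, by simp, hy⟩

open Classical in
lemma IsChainCurve.append {a b c : PosetHat P} {S S' : Finset (HasseEdge P)} {γ γ' : ℝ → ℝ}
    (h : D.IsChainCurve a b S γ) (h' : D.IsChainCurve b c S' γ') :
    D.IsChainCurve a c (S ∪ S') fun y => if y ≤ (D.pos b).2 then γ y else γ' y where
  le := h.le.trans h'.le
  continuous := Continuous.if_le h.continuous h'.continuous continuous_id continuous_const
    (by rintro y (rfl : y = _); rw [h.upper, h'.lower])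
  lower := by rw [if_pos (D.height_strictMono.monotone h.le), h.lower]
  upper := by
    rcases (D.height_strictMono.monotone h'.le).eq_or_lt with hbc | hbc
    · rw [if_pos hbc.ge, ← hbc, h.upper, ← h'.lower, hbc, h'.upper]
    · rw [if_neg hbc.not_ge, h'.upper]
  mem := by
    intro e he
    rcases Finset.mem_union.1 he with he | he
    · obtain ⟨h1, h2, h3⟩ := h.mem e he
      refine ⟨h1, h2.trans h'.le, fun y hy => ?_⟩
      rw [if_pos (hy.2.trans (D.height_strictMono.monotone h2)), h3 y hy]
    · obtain ⟨h1, h2, h3⟩ := h'.mem e he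
      refine ⟨h.le.trans h1, h2, fun y hy => ?_⟩
      rcases ((D.height_strictMono.monotone h1).trans hy.1).eq_or_lt with hb | hb
      · rw [if_pos hb.ge, ← h3 y hy, ← hb, h.upper, h'.lower]
      · rw [if_neg hb.not_ge, h3 y hy]
  cover := by
    intro y hy
    rcases lt_or_ge y (D.pos b).2 with hyb | hyb
    · obtain ⟨e, he, he'⟩ := h.cover y ⟨hy.1, hyb⟩
      exact ⟨e, Finset.mem_union_left _ he, he'⟩
    · obtain ⟨e, he, he'⟩ := h'.cover y ⟨hyb, hy.2⟩
      exact ⟨e, Finset.mem_union_right _ he, he'⟩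

/-- An edge in both would end at or below `b` and start at or above it. Disjointness makes flow sums
additive under concatenation. -/
lemma IsChainCurve.disjoint {a b c : PosetHat P} {S S' : Finset (HasseEdge P)} {γ γ' : ℝ → ℝ}
    (h : D.IsChainCurve a b S γ) (h' : D.IsChainCurve b c S' γ') : Disjoint S S' := by
  rw [Finset.disjoint_left]
  intro e he he'
  exact absurd ((h.mem e he).2.1.trans (h'.mem e he').1) (not_le_of_gt e.2.lt)

lemma IsChainCurve.eq_empty {a : PosetHat P} {S : Finset (HasseEdge P)} {γ : ℝ → ℝ}
    (h : D.IsChainCurve a a S γ) : S = ∅ := by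
  rw [Finset.eq_empty_iff_forall_notMem]
  intro e he
  exact absurd ((h.mem e he).2.1.trans (h.mem e he).1) (not_le_of_gt e.2.lt)

variable (D) in
lemma exists_isChainCurve {a : PosetHat P} (b : PosetHat P) (hab : a ≤ b) :
    ∃ S γ, D.IsChainCurve a b S γ := by
  induction b using WellFoundedLT.induction with
  | ind b ih =>
    rcases hab.eq_or_lt with rfl | hab
    · exact ⟨_, _, .refl a⟩
    · obtain ⟨c, hac, hcb⟩ := exists_le_covBy_of_lt hab
      obtain ⟨S, γ, h⟩ := ih c hcb.lt hac
      exact ⟨_, _, h.append (.edge ⟨(c, b), hcb⟩)⟩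

open Classical in
/-- The side of a maximal chain on which a face lies jumps exactly across the edges of the chain. -/
theorem IsChainCurve.exists_side {S : Finset (HasseEdge P)} {γ : ℝ → ℝ}
    (h : D.IsChainCurve ⊥ ⊤ S γ) : ∃ s : D.BoundedFace → ℝ, s D.sourceFace = 0 ∧
      s D.sinkFace = 1 ∧ ∀ e, s (D.rightFace e) - s (D.leftFace e) = if e ∈ S then 1 else 0 := by
  -- Inside the region `γ` runs along drawn edges, so no face meets it; a face, being connected,
  -- lies entirely on one side.
  have hne : ∀ F : D.BoundedFace, ∀ z ∈ F.1, z.1 ≠ γ z.2 := by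
    intro F z hz hγ
    obtain ⟨e, he, he'⟩ := h.cover z.2 (Ioo_subset_Ico_self (D.mem_region_of_mem F hz).1)
    have he'' := Ico_subset_Icc_self he'
    refine D.not_mem_support_of_mem F hz ⟨.inl e, he'', ?_⟩
    rw [hγ, D.curves_inl he'', (h.mem e he).2.2 _ he'']
  have hside : ∀ F : D.BoundedFace, ∀ z ∈ F.1, γ z.2 < z.1 → ∀ w ∈ F.1, γ w.2 < w.1 := by
    intro F z hz hzγ w hw
    have hpre : IsPreconnected F.1 := by
      obtain ⟨w, hw, hR, rfl⟩ := D.exists_eq_faceOf F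
      exact isPreconnected_connectedComponentIn
    have hγ := h.continuous
    have := hpre.subset_left_of_subset_union
      (isOpen_lt (hγ.comp continuous_snd) continuous_fst)
      (isOpen_lt continuous_fst (hγ.comp continuous_snd)) (by
        rw [Set.disjoint_left]
        exact fun z (h1 : γ z.2 < z.1) (h2 : z.1 < γ z.2) => lt_asymm h1 h2)
      (fun z hz => (lt_or_gt_of_ne (hne F z hz)).symm) ⟨z, hz, hzγ⟩
    exact this hw
  set s : D.BoundedFace → ℝ := fun F => if ∃ z ∈ F.1, γ z.2 < z.1 then 1 else 0 with hs
  have hs1 : ∀ F : D.BoundedFace, ∀ z ∈ F.1, γ z.2 < z.1 → s F = 1 := fun F z hz hzγ =>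
    if_pos ⟨z, hz, hzγ⟩
  have hs0 : ∀ F : D.BoundedFace, ∀ z ∈ F.1, z.1 < γ z.2 → s F = 0 := fun F z hz hzγ =>
    if_neg fun ⟨w, hw, hwγ⟩ => lt_asymm hzγ (hside F w hw hwγ z hz)
  have hcurve : ∀ y ∈ Ioo (D.pos ⊥).2 (D.pos ⊤).2, ∃ e ∈ S,
      y ∈ Icc (D.pos e.1.1).2 (D.pos e.1.2).2 ∧ γ y = D.curve e y := by
    intro y hy
    obtain ⟨e, he, he'⟩ := h.cover y (Ioo_subset_Ico_self hy)
    exact ⟨e, he, Ico_subset_Icc_self he', (h.mem e he).2.2 _ (Ico_subset_Icc_self he')⟩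
  refine ⟨s, ?_, ?_, fun e => ?_⟩
  · obtain ⟨y, hy⟩ := D.exists_height
    obtain ⟨e, he, he', hγ⟩ := hcurve y hy
    obtain ⟨x, ⟨⟨hx1, hx2⟩, -⟩, hx3⟩ := ((D.eventually_source hy).and
      (Ioo_mem_nhdsGT (D.left_lt y hy e he'))).exists
    refine hs0 _ (x, y) ?_ (hγ ▸ hx3.2)
    change (x, y) ∈ D.curves.rightFace (.inr false)
    rw [← hx2]
    exact mem_connectedComponentIn hx1
  · obtain ⟨y, hy⟩ := D.exists_height
    obtain ⟨e, he, he', hγ⟩ := hcurve y hy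
    obtain ⟨x, ⟨⟨hx1, hx2⟩, -⟩, hx3⟩ := ((D.eventually_sink hy).and
      (Ioo_mem_nhdsLT (D.lt_right y hy e he'))).exists
    refine hs1 _ (x, y) ?_ (hγ ▸ hx3.1)
    change (x, y) ∈ D.curves.leftFace (.inr true)
    rw [← hx2]
    exact mem_connectedComponentIn hx1
  · set y := ((D.pos e.1.1).2 + (D.pos e.1.2).2) / 2 with hy
    have hyI := D.mid_mem e
    rw [← hy] at hyI
    have hL := D.isLeftFace_leftFace e y hyI
    have hR := D.isRightFace_rightFace e y hyI
    split_ifs with heS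
    · have hγ := (h.mem e heS).2.2 y (Ioo_subset_Icc_self hyI)
      obtain ⟨a, ha, ha'⟩ := (hL.and self_mem_nhdsWithin).exists
      obtain ⟨b, hb, hb'⟩ := (hR.and self_mem_nhdsWithin).exists
      rw [hs1 _ _ hb (by simp only [hγ]; exact hb'), hs0 _ _ ha (by simp only [hγ]; exact ha'),
        sub_zero]
    -- An edge outside the chain is at positive distance from `γ` at its middle height, so points
    -- close to it on either side are on the same side of `γ`.
    · obtain ⟨e', he', hye', hγ⟩ := hcurve y (D.mem_Ioo_of_mem_Ioo hyI)
      have hee : D.curve e y ≠ γ y := by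
        rw [hγ]
        exact D.curve_ne_of_ne (by rintro rfl; exact heS he') hyI hye'
      rw [sub_eq_zero]
      rcases lt_or_gt_of_ne hee with hlt | hlt
      · obtain ⟨a, ha, ha'⟩ := (hL.and (nhdsWithin_le_nhds (Iio_mem_nhds hlt))).exists
        obtain ⟨b, hb, hb'⟩ := (hR.and (nhdsWithin_le_nhds (Iio_mem_nhds hlt))).exists
        rw [hs0 _ _ hb hb', hs0 _ _ ha ha']
      · obtain ⟨a, ha, ha'⟩ := (hL.and (nhdsWithin_le_nhds (Ioi_mem_nhds hlt))).exists
        obtain ⟨b, hb, hb'⟩ := (hR.and (nhdsWithin_le_nhds (Ioi_mem_nhds hlt))).exists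
        rw [hs1 _ _ hb hb', hs1 _ _ ha ha']

end AugmentedDrawing

/-! ### Numberings of the dual graph; flows as differences of order preserving functions -/

namespace AugmentedDrawing

variable {P : Type*} [PartialOrder P] [Finite P] (D : AugmentedDrawing P)

lemma exists_isChainCurve_mem (e : HasseEdge P) : ∃ S γ, D.IsChainCurve ⊥ ⊤ S γ ∧ e ∈ S := by
  classical
  obtain ⟨S, γ, h⟩ := D.exists_isChainCurve e.1.1 bot_le
  obtain ⟨S', γ', h'⟩ := D.exists_isChainCurve (a := e.1.2) ⊤ le_top
  exact ⟨_, _, (h.append (.edge e)).append h', by simp⟩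

lemma sourceFace_ne_sinkFace : D.sourceFace ≠ D.sinkFace := by
  obtain ⟨S, γ, h⟩ := D.exists_isChainCurve (a := ⊥) ⊤ bot_le
  obtain ⟨s, h0, h1, -⟩ := h.exists_side
  intro h
  rw [h, h1] at h0
  exact one_ne_zero h0

/-- The left-to-right order of the faces is acyclic. -/
lemma exists_potential : ∃ w : D.BoundedFace → ℝ, ∀ e, w (D.leftFace e) < w (D.rightFace e) := by
  classical
  choose S γ h hS using D.exists_isChainCurve_mem
  choose s _ _ hs using fun e => (h e).exists_side
  -- One maximal chain is chosen through each edge. No side function decreases from left to right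
  -- across an edge, and that of the chain through `e` increases across `e`.
  refine ⟨fun F => ∑ e, s e F, fun e => ?_⟩
  rw [← sub_pos, ← Finset.sum_sub_distrib]
  simp only [hs]
  refine Finset.sum_pos' (fun e' _ => ?_) ⟨e, Finset.mem_univ _, ?_⟩
  · split_ifs <;> norm_num
  · simp [hS e]

/-- A numbering of the bounded faces that is compatible with the directions of the dual edges. -/
def IsNumbering {k : ℕ} (φ : Fin k ≃ D.BoundedFace) : Prop :=
  ∀ e, φ.symm (D.leftFace e) < φ.symm (D.rightFace e)

/-- Sort the faces by the potential. Ties are harmless, as the potential is strictly larger on the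
right of each edge. -/
lemma exists_isNumbering : ∃ (k : ℕ) (φ : Fin k ≃ D.BoundedFace), D.IsNumbering φ := by
  obtain ⟨w, hw⟩ := D.exists_potential
  let ψ := (Finite.equivFin D.BoundedFace).symm
  refine ⟨_, (Tuple.sort (w ∘ ψ)).trans ψ, fun e => ?_⟩
  by_contra h
  have := Tuple.monotone_sort (w ∘ ψ) (not_lt.1 h)
  simp only [Function.comp, Equiv.symm_trans_apply, Equiv.apply_symm_apply] at this
  exact absurd (hw e) this.not_gt

variable {D}

/-- The first vertex has no incoming edge, and every face other than the source has one. Hence all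
numberings agree on where the flow starts. -/
lemma IsNumbering.zero_iff {k : ℕ} {φ : Fin k ≃ D.BoundedFace} (h : D.IsNumbering φ) (v : Fin k) :
    (v : ℕ) = 0 ↔ φ v = D.sourceFace := by
  have key : ∀ v : Fin k, (v : ℕ) = 0 → φ v = D.sourceFace := by
    intro v hv
    by_contra hne
    obtain ⟨e, he⟩ := D.exists_rightFace_eq hne
    have := h e
    rw [he, Equiv.symm_apply_apply, Fin.lt_def] at this
    omega
  refine ⟨key v, fun hv => ?_⟩
  have := key ⟨0, v.pos⟩ rfl
  rw [← hv] at this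
  exact congrArg Fin.val (φ.injective this).symm

lemma IsNumbering.last_iff {k : ℕ} {φ : Fin k ≃ D.BoundedFace} (h : D.IsNumbering φ) (v : Fin k) :
    (v : ℕ) + 1 = k ↔ φ v = D.sinkFace := by
  have key : ∀ v : Fin k, (v : ℕ) + 1 = k → φ v = D.sinkFace := by
    intro v hv
    by_contra hne
    obtain ⟨e, he⟩ := D.exists_leftFace_eq hne
    have := h e
    rw [he, Equiv.symm_apply_apply, Fin.lt_def] at this
    omega
  refine ⟨key v, fun hv => ?_⟩
  have hk := v.pos
  have := key ⟨k - 1, by omega⟩ (by simp only; omega)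
  rw [← hv] at this
  have := congrArg Fin.val (φ.injective this).symm
  simp only at this
  omega

/-- The truncated dual with a given numbering of its vertices. -/
def IsNumbering.graph {k : ℕ} {φ : Fin k ≃ D.BoundedFace} (h : D.IsNumbering φ) :
    OrderedGraph k (HasseEdge P) where
  tail e := φ.symm (D.leftFace e)
  head e := φ.symm (D.rightFace e)
  tail_lt_head := h
  connected := by
    set v₀ := φ.symm D.sourceFace with hv₀
    -- Each vertex other than the source has an edge coming from a smaller vertex, so following such
    -- edges backwards ends at the source.
    have key : ∀ n : ℕ, ∀ v : Fin k, (v : ℕ) = n → (SimpleGraph.fromRel fun u v =>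
        ∃ e, φ.symm (D.leftFace e) = u ∧ φ.symm (D.rightFace e) = v).Reachable v₀ v := by
      intro n
      induction n using Nat.strong_induction_on with
      | _ n ih =>
        rintro v rfl
        by_cases hv : φ v = D.sourceFace
        · rw [← hv, Equiv.symm_apply_apply] at hv₀
          rw [hv₀]
        · obtain ⟨e, he⟩ := D.exists_rightFace_eq hv
          have hlt := h e
          have hv' : φ.symm (D.rightFace e) = v := by rw [he, Equiv.symm_apply_apply]
          rw [hv'] at hlt
          refine (ih _ hlt _ rfl).trans (SimpleGraph.Adj.reachable ?_)
          rw [SimpleGraph.fromRel_adj]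
          exact ⟨hlt.ne, Or.inl ⟨e, rfl, hv'⟩⟩
    exact (SimpleGraph.connected_iff_exists_forall_reachable _).2 ⟨v₀, fun v => key _ v rfl⟩

theorem exists_isTruncatedDual :
    ∃ (k : ℕ) (G : OrderedGraph k (HasseEdge P)), IsTruncatedDual D G := by
  obtain ⟨k, φ, h⟩ := D.exists_isNumbering
  refine ⟨k, h.graph, φ, fun e => ?_⟩
  simp only [IsNumbering.graph, Equiv.apply_symm_apply]
  exact ⟨D.isLeftFace_leftFace e, D.isRightFace_rightFace e⟩

lemma exists_numbering {k : ℕ} {G : OrderedGraph k (HasseEdge P)} (hG : IsTruncatedDual D G) :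
    ∃ φ : Fin k ≃ D.BoundedFace, D.IsNumbering φ ∧
      (∀ e, φ (G.tail e) = D.leftFace e) ∧ ∀ e, φ (G.head e) = D.rightFace e := by
  obtain ⟨φ, hφ⟩ := hG
  have h1 : ∀ e, φ (G.tail e) = D.leftFace e := fun e => D.eq_leftFace (hφ e).1
  have h2 : ∀ e, φ (G.head e) = D.rightFace e := fun e => D.eq_rightFace (hφ e).2
  refine ⟨φ, fun e => ?_, h1, h2⟩
  rw [← h1, ← h2, Equiv.symm_apply_apply, Equiv.symm_apply_apply]
  exact G.tail_lt_head e

/-- Summation by parts on the dual side: regroup by vertices, so that only the net inflow matters.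
-/
lemma sum_mul_jump {k : ℕ} {E : Type*} [Fintype E] (G : OrderedGraph k E) (fl : E → ℝ)
    (g : Fin k → ℝ) : ∑ e, fl e * (g (G.head e) - g (G.tail e)) =
      ∑ v, g v * (∑ e with G.head e = v, fl e - ∑ e with G.tail e = v, fl e) := by
  simp only [mul_sub, Finset.sum_sub_distrib]
  congr 1
  · rw [← Finset.sum_fiberwise Finset.univ G.head]
    refine Finset.sum_congr rfl fun v _ => ?_
    rw [Finset.mul_sum]
    exact Finset.sum_congr rfl fun e he => by rw [(Finset.mem_filter.1 he).2, mul_comm]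
  · rw [← Finset.sum_fiberwise Finset.univ G.tail]
    refine Finset.sum_congr rfl fun v _ => ?_
    rw [Finset.mul_sum]
    exact Finset.sum_congr rfl fun e he => by rw [(Finset.mem_filter.1 he).2, mul_comm]

open Classical in
/-- Flows of size one in terms of the net flow into the vertices. -/
lemma mem_flowPolytope_iff_balance {k : ℕ} {G : OrderedGraph k (HasseEdge P)}
    {φ : Fin k ≃ D.BoundedFace} (hφ : D.IsNumbering φ) {fl : HasseEdge P → ℝ} :
    fl ∈ flowPolytope G ↔ (∀ e, 0 ≤ fl e) ∧ ∀ v,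
      ∑ e with G.head e = v, fl e - ∑ e with G.tail e = v, fl e =
        (if φ v = D.sinkFace then 1 else 0) - (if φ v = D.sourceFace then 1 else 0) := by
  set v₀ := φ.symm D.sourceFace with hv₀
  set v₁ := φ.symm D.sinkFace with hv₁
  have h0 : (v₀ : ℕ) = 0 := (hφ.zero_iff v₀).2 (by simp [hv₀])
  have h1 : (v₁ : ℕ) + 1 = k := (hφ.last_iff v₁).2 (by simp [hv₁])
  have e0 : (Finset.univ.filter fun e => (G.tail e : ℕ) = 0) =
      Finset.univ.filter fun e => G.tail e = v₀ := by
    ext e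
    simp only [Finset.mem_filter, Finset.mem_univ, true_and, Fin.ext_iff, h0]
  have e1 : (Finset.univ.filter fun e => (G.head e : ℕ) + 1 = k) =
      Finset.univ.filter fun e => G.head e = v₁ := by
    ext e
    simp only [Finset.mem_filter, Finset.mem_univ, true_and, Fin.ext_iff]
    omega
  -- Nothing enters the first vertex and nothing leaves the last, so the two normalisations become
  -- the balance conditions `-1` and `1` there.
  have i0 : ∑ e with G.head e = v₀, fl e = 0 := Finset.sum_eq_zero fun e he => by
    have := (Finset.mem_filter.1 he).2 ▸ G.tail_lt_head e
    rw [Fin.lt_def] at this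
    omega
  have o1 : ∑ e with G.tail e = v₁, fl e = 0 := Finset.sum_eq_zero fun e he => by
    have := (Finset.mem_filter.1 he).2 ▸ G.tail_lt_head e
    rw [Fin.lt_def] at this
    omega
  have hne := D.sourceFace_ne_sinkFace
  unfold flowPolytope
  rw [mem_ofPred_eq, e0, e1]
  refine and_congr_right fun _ => ⟨?_, ?_⟩
  · rintro ⟨hs, ht, hc⟩ v
    by_cases hv0 : φ v = D.sourceFace
    · obtain rfl : v = v₀ := by rw [hv₀, ← hv0, Equiv.symm_apply_apply]
      rw [i0, hs, if_pos hv0, if_neg (hv0 ▸ hne)]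
    · by_cases hv1 : φ v = D.sinkFace
      · obtain rfl : v = v₁ := by rw [hv₁, ← hv1, Equiv.symm_apply_apply]
        rw [o1, ht, if_pos hv1, if_neg hv0]
      · rw [if_neg hv0, if_neg hv1, sub_self, sub_eq_zero]
        refine hc v (Nat.pos_of_ne_zero fun h => hv0 ((hφ.zero_iff v).1 h)) ?_
        have : (v : ℕ) + 1 ≠ k := fun h => hv1 ((hφ.last_iff v).1 h)
        omega
  · intro h
    refine ⟨?_, ?_, ?_⟩
    · have := h v₀
      rw [i0, φ.apply_symm_apply, if_neg hne, if_pos rfl] at this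
      linarith
    · have := h v₁
      rw [o1, φ.apply_symm_apply, if_pos rfl, if_neg hne.symm] at this
      linarith
    · intro v hv0 hv1
      have := h v
      rw [if_neg (fun h => hv1.ne ((hφ.last_iff v).2 h)),
        if_neg (fun h => hv0.ne' ((hφ.zero_iff v).2 h)), sub_self] at this
      linarith

/-- The flows of size one on the truncated dual are the differences of the order preserving
functions with value `0` at the bottom and `1` at the top. -/
theorem mem_flowPolytope_iff {k : ℕ} {G : OrderedGraph k (HasseEdge P)} (hG : IsTruncatedDual D G)
    {fl : HasseEdge P → ℝ} : fl ∈ flowPolytope G ↔ ∃ f : PosetHat P → ℝ,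
      f ⊥ = 0 ∧ f ⊤ = 1 ∧ Monotone f ∧ fl = fun e => f e.1.2 - f e.1.1 := by
  classical
  obtain ⟨φ, hφ, htail, hhead⟩ := exists_numbering hG
  rw [mem_flowPolytope_iff_balance hφ]
  constructor
  · rintro ⟨hpos, hbal⟩
    -- Pair the flow with the side function of the chain: the edges give the sum over the chain, the
    -- vertices give sink value minus source value.
    have hsum : ∀ S γ, D.IsChainCurve ⊥ ⊤ S γ → ∑ e ∈ S, fl e = 1 := by
      intro S γ h
      obtain ⟨s, hs0, hs1, hs⟩ := h.exists_side
      have h1 := sum_mul_jump G fl (s ∘ φ)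
      simp only [Function.comp, hhead, htail, hs, hbal, mul_sub, mul_ite, mul_one, mul_zero,
        Finset.sum_sub_distrib] at h1
      rw [Finset.sum_ite_mem, Finset.univ_inter, Finset.sum_eq_single (φ.symm D.sinkFace),
        Finset.sum_eq_single (φ.symm D.sourceFace)] at h1
      · simpa [hs0, hs1] using h1
      · intro v _ hv
        rw [if_neg fun h => hv (by rw [← h, Equiv.symm_apply_apply])]
      · simp
      · intro v _ hv
        rw [if_neg fun h => hv (by rw [← h, Equiv.symm_apply_apply])]
      · simp
    choose S γ hS using fun p => D.exists_isChainCurve (a := ⊥) p bot_le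
    -- Completing both chains from `⊥` to `b` by the same chain from `b` to `⊤` gives two maximal
    -- chains, both of total flow `1`. So the choice of the chains `S p` does not matter.
    have hstep : ∀ a b T δ, D.IsChainCurve a b T δ →
        ∑ e ∈ S b, fl e - ∑ e ∈ S a, fl e = ∑ e ∈ T, fl e := by
      intro a b T δ hT
      obtain ⟨U, ε, hU⟩ := D.exists_isChainCurve (a := b) ⊤ le_top
      have h1 := hsum _ _ (((hS a).append hT).append hU)
      have h2 := hsum _ _ ((hS b).append hU)
      rw [Finset.sum_union (((hS a).append hT).disjoint hU),
        Finset.sum_union ((hS a).disjoint hT)] at h1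
      rw [Finset.sum_union ((hS b).disjoint hU)] at h2
      linarith
    refine ⟨fun p => ∑ e ∈ S p, fl e, ?_, hsum _ _ (hS ⊤), ?_, ?_⟩
    · simp only
      rw [(hS ⊥).eq_empty, Finset.sum_empty]
    · intro a b hab
      obtain ⟨T, δ, hT⟩ := D.exists_isChainCurve b hab
      have := hstep a b T δ hT
      have := Finset.sum_nonneg fun e (_ : e ∈ T) => hpos e
      simp only
      linarith
    · funext e
      rw [hstep _ _ _ _ (.edge e), Finset.sum_singleton]
  · rintro ⟨f, hf0, hf1, hf, rfl⟩
    refine ⟨fun e => sub_nonneg.2 (hf e.2.le), fun v => ?_⟩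
    -- Testing both summations by parts against the indicator of a single face isolates the balance
    -- at that vertex.
    have h1 := D.sum_diff_mul_jump f fun F => if F = φ v then 1 else 0
    have h2 := sum_mul_jump G (fun e => f e.1.2 - f e.1.1) fun u => if φ u = φ v then 1 else 0
    simp only [hhead, htail] at h2
    rw [h1, hf0, hf1] at h2
    simp only [EmbeddingLike.apply_eq_iff_eq, ite_mul, one_mul, zero_mul, Finset.sum_ite_eq',
      Finset.mem_univ, if_true, sub_zero] at h2
    rw [← h2]
    simp only [eq_comm]

end AugmentedDrawing

/-! ### Corner sums -/

section CornerSum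

variable {m n : ℕ}

/-- The sum of the entries in the first `a` rows and the first `b` columns. -/
def cornerSum (a b : ℕ) : (Fin m × Fin n → ℝ) →ₗ[ℝ] ℝ :=
  ∑ x : Fin m × Fin n with (x.1 : ℕ) < a ∧ (x.2 : ℕ) < b, LinearMap.proj x

lemma cornerSum_apply (a b : ℕ) (A : Fin m × Fin n → ℝ) :
    cornerSum a b A = ∑ x : Fin m × Fin n with (x.1 : ℕ) < a ∧ (x.2 : ℕ) < b, A x := by
  simp [cornerSum]

lemma cornerSum_zero_left (b : ℕ) (A : Fin m × Fin n → ℝ) : cornerSum 0 b A = 0 := by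
  simp [cornerSum_apply]

lemma cornerSum_zero_right (a : ℕ) (A : Fin m × Fin n → ℝ) : cornerSum a 0 A = 0 := by
  simp [cornerSum_apply]

/-- Inclusion and exclusion for four rectangles. The integral coefficients make integrality of
entries and of corner sums equivalent. -/
lemma eq_cornerSum (A : Fin m × Fin n → ℝ) (i : Fin m) (j : Fin n) :
    A (i, j) = cornerSum (i + 1) (j + 1) A - cornerSum i (j + 1) A - cornerSum (i + 1) j A +
      cornerSum i j A := by
  simp only [cornerSum_apply, Finset.sum_filter]
  rw [← Finset.sum_sub_distrib, ← Finset.sum_sub_distrib, ← Finset.sum_add_distrib,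
    Finset.sum_eq_single (i, j)]
  · simp
  · rintro ⟨i', j'⟩ - hne
    have h : ¬ ((i' : ℕ) = i ∧ (j' : ℕ) = j) := by
      rintro ⟨h1, h2⟩
      exact hne (Prod.ext (Fin.ext h1) (Fin.ext h2))
    simp only
    split_ifs <;> first | omega | simp
  · simp

/-- A property of real numbers that is stable under addition and subtraction passes from the corner
sums to the entries. -/
lemma entry_mem_of_cornerSum_mem (H : AddSubgroup ℝ) (A : Fin m × Fin n → ℝ)
    (h : ∀ i < m, ∀ j < n, cornerSum (i + 1) (j + 1) A ∈ H) (x : Fin m × Fin n) : A x ∈ H := by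
  have key : ∀ a ≤ m, ∀ b ≤ n, cornerSum a b A ∈ H := by
    rintro (_ | i) hi (_ | j) hj
    · rw [cornerSum_zero_left]; exact H.zero_mem
    · rw [cornerSum_zero_left]; exact H.zero_mem
    · rw [cornerSum_zero_right]; exact H.zero_mem
    · exact h i hi j hj
  obtain ⟨i, j⟩ := x
  rw [eq_cornerSum A i j]
  have hi := i.2
  have hj := j.2
  exact H.add_mem (H.sub_mem (H.sub_mem (key _ hi _ hj) (key _ hi.le _ hj)) (key _ hi _ hj.le))
    (key _ hi.le _ hj.le)

/-- The column sums telescope: row `k + 1` moves the single `1` from column `μ.rowLen k` to column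
`μ.rowLen (k + 1)`, and is zero if these coincide. -/
lemma sum_partitionMatrixEntry (μ : YoungDiagram) (i j : ℕ) :
    ∑ k ∈ Finset.range (i + 1), partitionMatrixEntry μ k j = if j = μ.rowLen i then 1 else 0 := by
  induction i with
  | zero => simp [partitionMatrixEntry]
  | succ i ih =>
    rw [Finset.sum_range_succ, ih]
    have hanti : μ.rowLen (i + 1) ≤ μ.rowLen i := μ.rowLen_anti i (i + 1) (Nat.le_succ i)
    simp only [partitionMatrixEntry]
    split_ifs <;> omega

/-- The matrix of a partition as a point of `ℝ^{mn}`. -/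
def partitionPoint (m n : ℕ) (μ : YoungDiagram) : Fin m × Fin n → ℝ :=
  fun c => (partitionMatrix μ m n c.1 c.2 : ℝ)

open Classical in
/-- The corner sums of the matrix of a partition indicate the complement of the partition. -/
lemma cornerSum_partitionPoint (μ : YoungDiagram) {i j : ℕ} (hi : i < m) (hj : j < n) :
    cornerSum (i + 1) (j + 1) (partitionPoint m n μ) = if (i, j) ∈ μ then 0 else 1 := by
  have h1 : (Finset.univ.filter fun x : Fin m × Fin n => (x.1 : ℕ) < i + 1 ∧ (x.2 : ℕ) < j + 1) =
      (Finset.univ.filter fun x : Fin m => (x : ℕ) < i + 1) ×ˢ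
        (Finset.univ.filter fun x : Fin n => (x : ℕ) < j + 1) := by
    ext; simp
  have hfin : ∀ (N a : ℕ), a ≤ N → ∀ f : ℕ → ℝ,
      ∑ x ∈ Finset.univ.filter (fun x : Fin N => (x : ℕ) < a), f x =
        ∑ x ∈ Finset.range a, f x := by
    intro N a ha f
    rw [Finset.sum_filter, Fin.sum_univ_eq_sum_range (fun x => if x < a then f x else 0),
      ← Finset.sum_filter]
    congr 1
    ext x
    simp only [Finset.mem_filter, Finset.mem_range]
    omega
  -- Summing down each column first leaves a single `1` in column `μ.rowLen i`, counted exactly when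
  -- `μ.rowLen i ≤ j`.
  rw [cornerSum_apply, h1, Finset.sum_product_right]
  simp only [partitionPoint, partitionMatrix, Matrix.of_apply]
  rw [hfin n (j + 1) hj fun b =>
    ∑ a ∈ Finset.univ.filter (fun a : Fin m => (a : ℕ) < i + 1),
    ((partitionMatrixEntry μ a b : ℤ) : ℝ)]
  have h3 : ∀ b, ∑ a ∈ Finset.univ.filter (fun a : Fin m => (a : ℕ) < i + 1),
      ((partitionMatrixEntry μ a b : ℤ) : ℝ) = _ := fun b =>
    hfin m (i + 1) hi fun a => ((partitionMatrixEntry μ a b : ℤ) : ℝ)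
  have h2 : ∀ b, ∑ a ∈ Finset.range (i + 1), ((partitionMatrixEntry μ a b : ℤ) : ℝ) =
      if b = μ.rowLen i then 1 else 0 := by
    intro b
    have := congrArg (Int.cast : ℤ → ℝ) (sum_partitionMatrixEntry μ i b)
    push_cast at this
    simpa using this
  simp only [h3, h2, Finset.sum_ite_eq', Finset.mem_range, YoungDiagram.mem_iff_lt_rowLen]
  split_ifs <;> first | rfl | omega

end CornerSum

/-! ### The affine map from matrices to flows -/

section Transfer

variable {m n : ℕ} {nu lam : YoungDiagram}

/-- The value of a matrix at a vertex of the extended poset: `0` at the bottom, `1` at the top, and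
the corner sum at a box. -/
def vertexValue (m n : ℕ) : PosetHat (SkewPoset nu lam) → (Fin m × Fin n → ℝ) →ᵃ[ℝ] ℝ :=
  WithBot.recBotCoe (AffineMap.const ℝ _ 0) (WithTop.recTopCoe (AffineMap.const ℝ _ 1)
    fun c => (cornerSum (c.1.1 + 1) (c.1.2 + 1)).toAffineMap)

@[simp] lemma vertexValue_bot (A : Fin m × Fin n → ℝ) :
    vertexValue (nu := nu) (lam := lam) m n ⊥ A = 0 := rfl

@[simp] lemma vertexValue_top (A : Fin m × Fin n → ℝ) :
    vertexValue (nu := nu) (lam := lam) m n ⊤ A = 1 := rfl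

@[simp] lemma vertexValue_coe (c : SkewPoset nu lam) (A : Fin m × Fin n → ℝ) :
    vertexValue m n ((c : WithTop (SkewPoset nu lam)) : PosetHat (SkewPoset nu lam)) A = cornerSum (c.1.1 + 1) (c.1.2 + 1) A := rfl

/-- The affine map that sends a matrix to the differences of its vertex values. -/
def flowMap (nu lam : YoungDiagram) (m n : ℕ) :
    (Fin m × Fin n → ℝ) →ᵃ[ℝ] (HasseEdge (SkewPoset nu lam) → ℝ) :=
  AffineMap.pi fun e => vertexValue m n e.1.2 - vertexValue m n e.1.1

lemma flowMap_apply (A : Fin m × Fin n → ℝ) (e : HasseEdge (SkewPoset nu lam)) :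
    flowMap nu lam m n A e = vertexValue m n e.1.2 A - vertexValue m n e.1.1 A := rfl

/-- The matrices whose convex hull is the polytope. -/
def partitionPoints (nu lam : YoungDiagram) (m n : ℕ) : Set (Fin m × Fin n → ℝ) :=
  {v | ∃ μ : YoungDiagram, lam ≤ μ ∧ μ ≤ nu ∧ v = partitionPoint m n μ}

lemma pasmPolytope_eq : pasmPolytope nu lam m n = convexHull ℝ (partitionPoints nu lam m n) := rfl

lemma AffineMap.eq_of_mem_affineSpan {V W : Type*} [AddCommGroup V] [Module ℝ V] [AddCommGroup W]
    [Module ℝ W] (f : V →ᵃ[ℝ] W) {s : Set V} {w : W} (h : ∀ x ∈ s, f x = w) {x : V}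
    (hx : x ∈ affineSpan ℝ s) : f x = w := by
  refine affineSpan_induction (p := fun x => f x = w) hx h fun c u v z hu hv hz => ?_
  rw [AffineMap.map_vadd, map_smul, AffineMap.linearMap_vsub, hu, hv, hz]
  simp

/-- These corner sums are the same for all generators because `λ ⊆ μ ⊆ ν`, and an affine function
constant on the generators is constant on their hull. Only the corner sums at boxes of the poset
remain free. -/
lemma cornerSum_of_mem_affineSpan {A : Fin m × Fin n → ℝ}
    (hA : A ∈ affineSpan ℝ (pasmPolytope nu lam m n)) {i j : ℕ} (hi : i < m) (hj : j < n) :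
    ((i, j) ∈ lam → cornerSum (i + 1) (j + 1) A = 0) ∧
      ((i, j) ∉ nu → cornerSum (i + 1) (j + 1) A = 1) := by
  classical
  rw [pasmPolytope_eq, affineSpan_convexHull] at hA
  constructor <;> intro h <;>
    refine (cornerSum (i + 1) (j + 1)).toAffineMap.eq_of_mem_affineSpan ?_ hA <;>
    rintro _ ⟨μ, h1, h2, rfl⟩ <;>
    rw [LinearMap.coe_toAffineMap, cornerSum_partitionPoint μ hi hj]
  · exact if_pos (h1 h)
  · exact if_neg fun h' => h (h2 h')

lemma covBy_induction {Q : Type*} [PartialOrder Q] [OrderBot Q] [Finite Q] (p : Q → Prop)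
    (h0 : p ⊥) (h : ∀ a b, a ⋖ b → p a → p b) (a : Q) : p a := by
  induction a using WellFoundedLT.induction with
  | ind b ih =>
    rcases eq_bot_or_bot_lt b with rfl | hb
    · exact h0
    · obtain ⟨c, -, hcb⟩ := exists_le_covBy_of_lt hb
      exact h c b hcb (ih c hcb.lt)

/-- On the affine hull of the polytope all corner sums lie in a subgroup containing `1` as soon as
those that belong to boxes of the poset do. -/
lemma entry_mem_of_flowMap_mem {A : Fin m × Fin n → ℝ} (H : AddSubgroup ℝ) (h : ∀ i < m, ∀ j < n,
      ((i, j) ∈ lam → cornerSum (i + 1) (j + 1) A ∈ H) ∧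
      ((i, j) ∉ nu → cornerSum (i + 1) (j + 1) A ∈ H))
    (hA : ∀ e, flowMap nu lam m n A e ∈ H) (x : Fin m × Fin n) : A x ∈ H := by
  have hv : ∀ v : PosetHat (SkewPoset nu lam), vertexValue m n v A ∈ H := by
    refine covBy_induction _ (by simp) fun a b hab ha => ?_
    have := H.add_mem (hA ⟨(a, b), hab⟩) ha
    rwa [flowMap_apply, sub_add_cancel] at this
  refine entry_mem_of_cornerSum_mem H A (fun i hi j hj => ?_) x
  by_cases h1 : (i, j) ∈ lam
  · exact (h i hi j hj).1 h1
  by_cases h2 : (i, j) ∈ nu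
  · exact hv (((⟨(i, j), h2, h1⟩ : SkewPoset nu lam) : WithTop (SkewPoset nu lam)) :
      PosetHat (SkewPoset nu lam))
  · exact (h i hi j hj).2 h2

/-- Differences along covers determine the vertex values upwards from `⊥`; the other corner sums are
fixed on the hull, and corner sums determine the entries. -/
lemma flowMap_injOn :
    InjOn (flowMap nu lam m n) (affineSpan ℝ (pasmPolytope nu lam m n) : Set (Fin m × Fin n → ℝ)) := by
  intro A hA B hB hAB
  have hv : ∀ v : PosetHat (SkewPoset nu lam), vertexValue m n v A = vertexValue m n v B := by
    refine covBy_induction _ rfl fun a b hab ha => ?_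
    have := congrFun hAB ⟨(a, b), hab⟩
    rw [flowMap_apply, flowMap_apply] at this
    simp only at this
    linarith
  -- The trivial subgroup turns the membership lemma into a vanishing statement for `A - B`.
  have key : ∀ x, (A - B) x ∈ (⊥ : AddSubgroup ℝ) := by
    refine entry_mem_of_cornerSum_mem ⊥ (A - B) fun i hi j hj => ?_
    rw [AddSubgroup.mem_bot, map_sub, sub_eq_zero]
    obtain ⟨a0, a1⟩ := cornerSum_of_mem_affineSpan hA hi hj
    obtain ⟨b0, b1⟩ := cornerSum_of_mem_affineSpan hB hi hj
    by_cases h1 : (i, j) ∈ lam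
    · rw [a0 h1, b0 h1]
    by_cases h2 : (i, j) ∈ nu
    · exact hv (((⟨(i, j), h2, h1⟩ : SkewPoset nu lam) : WithTop (SkewPoset nu lam)) :
        PosetHat (SkewPoset nu lam))
    · rw [a1 h2, b1 h2]
  funext x
  exact sub_eq_zero.1 (AddSubgroup.mem_bot.1 (key x))

/-- The subgroup of integers in `ℝ`. -/
def integers : AddSubgroup ℝ := (Int.castAddHom ℝ).range

lemma mem_integerPoints_iff {ι : Type*} {x : ι → ℝ} :
    x ∈ integerPoints ι ↔ ∀ i, x i ∈ integers :=
  forall_congr' fun _ => ⟨fun ⟨z, hz⟩ => ⟨z, hz.symm⟩, fun ⟨z, hz⟩ => ⟨z, hz.symm⟩⟩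

lemma flowMap_mem_integerPoints {A : Fin m × Fin n → ℝ} (hA : A ∈ integerPoints (Fin m × Fin n)) :
    flowMap nu lam m n A ∈ integerPoints _ := by
  rw [mem_integerPoints_iff] at hA ⊢
  have hv : ∀ v : PosetHat (SkewPoset nu lam), vertexValue m n v A ∈ integers := by
    intro v
    induction v using WithBot.recBotCoe with
    | bot => exact integers.zero_mem
    | coe v =>
      induction v using WithTop.recTopCoe with
      | top => exact ⟨1, by simp⟩
      | coe c =>
        rw [vertexValue_coe, cornerSum_apply]
        exact integers.sum_mem fun x _ => hA x
  exact fun e => integers.sub_mem (hv _) (hv _)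

lemma mem_integerPoints_of_flowMap {A : Fin m × Fin n → ℝ}
    (hA : A ∈ affineSpan ℝ (pasmPolytope nu lam m n))
    (h : flowMap nu lam m n A ∈ integerPoints _) : A ∈ integerPoints (Fin m × Fin n) := by
  rw [mem_integerPoints_iff] at h ⊢
  refine entry_mem_of_flowMap_mem integers (fun i hi j hj => ?_) h
  obtain ⟨a0, a1⟩ := cornerSum_of_mem_affineSpan hA hi hj
  exact ⟨fun h => a0 h ▸ integers.zero_mem, fun h => a1 h ▸ ⟨1, by simp⟩⟩

/-! ### The order polytope -/

open Classical in
/-- Every order preserving function on the poset with values in `[0, 1]` is given by the corner sums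
of a point of the polytope. -/
lemma exists_mem_pasmPolytope (hlam : lam ≤ nu) (hnu : ∀ c ∈ nu, c.1 + 1 < m ∧ c.2 + 1 < n)
    (f : SkewPoset nu lam → ℝ) (hf : Monotone f) (h0 : ∀ c, 0 ≤ f c) (h1 : ∀ c, f c ≤ 1) :
    ∃ A ∈ pasmPolytope nu lam m n, ∀ c, cornerSum (c.1.1 + 1) (c.1.2 + 1) A = f c := by
  have : Fintype (SkewPoset nu lam) := Fintype.ofFinite _
  -- Induction on the size of the support of `f`, peeling off one partition matrix at a time.
  induction hN : (Finset.univ.filter fun c => f c ≠ 0).card using Nat.strong_induction_on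
    generalizing f with
  | _ N ih =>
    -- the partition on which the function vanishes
    let μ : YoungDiagram :=
      { cells := nu.cells.filter fun c => c ∈ lam ∨ ∃ h, f ⟨c, h⟩ = 0
        isLowerSet := by
          intro c d hdc hc
          simp only [Finset.coe_filter, Set.mem_ofPred_eq, YoungDiagram.mem_cells] at hc ⊢
          have hd := nu.isLowerSet hdc hc.1
          refine ⟨hd, ?_⟩
          by_cases hdl : d ∈ lam
          · exact Or.inl hdl
          · have hcl : c ∉ lam := fun h => hdl (lam.isLowerSet hdc h)
            obtain ⟨hc', hfc⟩ := hc.2.resolve_left hcl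
            exact Or.inr ⟨⟨hd, hdl⟩, le_antisymm (hfc ▸ hf hdc) (h0 _)⟩ }
    have hμ : ∀ c, c ∈ μ ↔ c ∈ nu ∧ (c ∈ lam ∨ ∃ h, f ⟨c, h⟩ = 0) := fun c => by
      rw [← YoungDiagram.mem_cells]
      simp [μ]
    have hμmem : partitionPoint m n μ ∈ pasmPolytope nu lam m n :=
      subset_convexHull ℝ _ ⟨μ, fun c hc => (hμ c).2 ⟨hlam hc, Or.inl hc⟩,
        fun c hc => ((hμ c).1 hc).1, rfl⟩
    have hμval : ∀ c : SkewPoset nu lam,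
        cornerSum (c.1.1 + 1) (c.1.2 + 1) (partitionPoint m n μ) = if f c = 0 then 0 else 1 := by
      intro c
      have := hnu c.1 c.2.1
      rw [cornerSum_partitionPoint μ (by omega) (by omega)]
      have hiff : (c.1.1, c.1.2) ∈ μ ↔ f c = 0 := by
        rw [hμ]
        constructor
        · rintro ⟨-, h | ⟨_, h⟩⟩
          · exact absurd h c.2.2
          · exact h
        · intro h
          exact ⟨c.2.1, Or.inr ⟨c.2, h⟩⟩
      simp only [hiff]
    by_cases hS : ∃ c, f c ≠ 0 ∧ f c ≠ 1
    · obtain ⟨c₁, hc1, hc1'⟩ := hS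
      obtain ⟨c₀, hc₀, hmin⟩ := Finset.exists_min_image
        (Finset.univ.filter fun c => f c ≠ 0) f ⟨c₁, by simpa using hc1⟩
      simp only [Finset.mem_filter, Finset.mem_univ, true_and] at hc₀ hmin
      set ε := f c₀ with hε
      have hε0 : 0 < ε := lt_of_le_of_ne (h0 c₀) hc₀.symm
      have hε1 : ε < 1 := (hmin c₁ hc1).trans_lt (lt_of_le_of_ne (h1 c₁) hc1')
      have hε1' : 0 < 1 - ε := by linarith
      -- With `ε` the least nonzero value, `f` is `ε` times the indicator of its support plus `(1 -
      -- ε)` times `f'`. The support of `f'` is smaller, as it loses `c₀`.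
      let f' : SkewPoset nu lam → ℝ := fun c => if f c = 0 then 0 else (f c - ε) / (1 - ε)
      have hcard : (Finset.univ.filter fun c => f' c ≠ 0).card < N := by
        rw [← hN]
        refine Finset.card_lt_card (Finset.ssubset_iff_of_subset ?_ |>.2 ⟨c₀, ?_, ?_⟩)
        · intro c
          simp only [Finset.mem_filter, Finset.mem_univ, true_and, f']
          intro h h'
          exact h (if_pos h')
        · simpa using hc₀
        · simp [f', ← hε]
      have hmono : Monotone f' := by
        intro c d hcd
        simp only [f']
        have := hf hcd
        by_cases hc : f c = 0
        · rw [if_pos hc]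
          split_ifs with hd
          · exact le_rfl
          · exact div_nonneg (by linarith [hmin d hd]) hε1'.le
        · have hd : f d ≠ 0 := (lt_of_lt_of_le (lt_of_le_of_ne (h0 c) (Ne.symm hc)) this).ne'
          rw [if_neg hc, if_neg hd]
          gcongr
      have hf'0 : ∀ c, 0 ≤ f' c := by
        intro c
        simp only [f']
        split_ifs with hc
        · exact le_rfl
        · exact div_nonneg (by linarith [hmin c hc]) hε1'.le
      have hf'1 : ∀ c, f' c ≤ 1 := by
        intro c
        simp only [f']
        split_ifs with hc
        · exact zero_le_one
        · rw [div_le_one hε1']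
          linarith [h1 c]
      obtain ⟨A, hA, hA'⟩ := ih _ hcard f' hmono hf'0 hf'1 rfl
      refine ⟨ε • partitionPoint m n μ + (1 - ε) • A,
        convex_convexHull ℝ _ hμmem hA hε0.le hε1'.le (by ring), fun c => ?_⟩
      rw [map_add, map_smul, map_smul, hμval, hA']
      simp only [f', smul_eq_mul]
      split_ifs with h
      · rw [h]; ring
      · field_simp
        ring_nf
    · refine ⟨_, hμmem, fun c => ?_⟩
      rw [hμval]
      split_ifs with h
      · exact h.symm
      · by_contra h'
        exact hS ⟨c, h, Ne.symm h'⟩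

end Transfer

/-! ### The image of the polytope and the integral equivalence -/

section Equivalence

variable {m n : ℕ} {nu lam : YoungDiagram} {D : AugmentedDrawing (SkewPoset nu lam)} {k : ℕ}
  {G : OrderedGraph k (HasseEdge (SkewPoset nu lam))}

lemma convex_flowPolytope {k : ℕ} {E : Type*} [Fintype E] (G : OrderedGraph k E) :
    Convex ℝ (flowPolytope G) := by
  rintro x ⟨hx, hx0, hx1, hx2⟩ y ⟨hy, hy0, hy1, hy2⟩ a b ha hb hab
  refine ⟨fun e => ?_, ?_, ?_, fun v hv0 hv1 => ?_⟩
  · exact add_nonneg (mul_nonneg ha (hx e)) (mul_nonneg hb (hy e))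
  all_goals simp only [Pi.add_apply, Pi.smul_apply, smul_eq_mul, Finset.sum_add_distrib,
    ← Finset.mul_sum]
  · rw [hx0, hy0, mul_one, mul_one, hab]
  · rw [hx1, hy1, mul_one, mul_one, hab]
  · rw [hx2 v hv0 hv1, hy2 v hv0 hv1]

/-- By convexity one inclusion is needed only for partition matrices, whose vertex values are
monotone since partitions are lower sets. For the other, a flow comes from an order preserving
function, which the order polytope realises by corner sums. -/
lemma image_flowMap (hlam : lam ≤ nu) (hnu : ∀ c ∈ nu, c.1 + 1 < m ∧ c.2 + 1 < n)
    (hG : IsTruncatedDual D G) :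
    flowMap nu lam m n '' pasmPolytope nu lam m n = flowPolytope G := by
  classical
  apply Subset.antisymm
  · rw [pasmPolytope_eq, AffineMap.image_convexHull]
    refine convexHull_min ?_ (convex_flowPolytope G)
    rintro _ ⟨_, ⟨μ, hlμ, hμn, rfl⟩, rfl⟩
    rw [AugmentedDrawing.mem_flowPolytope_iff hG]
    refine ⟨fun v => vertexValue m n v (partitionPoint m n μ), rfl, rfl, ?_, rfl⟩
    have hval : ∀ c : SkewPoset nu lam,
        vertexValue m n ((c : WithTop (SkewPoset nu lam)) : PosetHat (SkewPoset nu lam))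
          (partitionPoint m n μ) = if c.1 ∈ μ then 0 else 1 := by
      intro c
      have := hnu c.1 c.2.1
      rw [vertexValue_coe, cornerSum_partitionPoint μ (by omega) (by omega)]
    have h01 : ∀ c : SkewPoset nu lam, (0 : ℝ) ≤ (if c.1 ∈ μ then 0 else 1) ∧
        (if c.1 ∈ μ then 0 else 1) ≤ (1 : ℝ) := fun c => by split_ifs <;> norm_num
    intro a b hab
    induction a using WithBot.recBotCoe with
    | bot =>
      induction b using WithBot.recBotCoe with
      | bot => exact le_rfl
      | coe b =>
        induction b using WithTop.recTopCoe with
        | top => exact zero_le_one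
        | coe d => simp only [hval]; exact (h01 d).1
    | coe a =>
      induction b using WithBot.recBotCoe with
      | bot => exact absurd (le_bot_iff.1 hab) WithBot.coe_ne_bot
      | coe b =>
        rw [WithBot.coe_le_coe] at hab
        induction b using WithTop.recTopCoe with
        | top =>
          induction a using WithTop.recTopCoe with
          | top => exact le_rfl
          | coe c => simp only [hval]; exact (h01 c).2
        | coe d =>
          induction a using WithTop.recTopCoe with
          | top => exact absurd (top_le_iff.1 hab) WithTop.coe_ne_top
          | coe c =>
            rw [WithTop.coe_le_coe] at hab
            simp only [hval]
            split_ifs with hc hd hd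
            · exact le_rfl
            · exact zero_le_one
            · exact absurd (μ.isLowerSet hab hd) hc
            · exact le_rfl
  · intro fl hfl
    rw [AugmentedDrawing.mem_flowPolytope_iff hG] at hfl
    obtain ⟨f, hf0, hf1, hf, rfl⟩ := hfl
    obtain ⟨A, hA, hA'⟩ := exists_mem_pasmPolytope hlam hnu
      (fun c => f ((c : WithTop (SkewPoset nu lam)) : PosetHat (SkewPoset nu lam)))
      (fun c d h => hf (WithBot.coe_le_coe.2 (WithTop.coe_le_coe.2 h)))
      (fun c => hf0 ▸ hf bot_le) (fun c => hf1 ▸ hf le_top)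
    refine ⟨A, hA, ?_⟩
    have hv : ∀ v, vertexValue m n v A = f v := by
      intro v
      induction v using WithBot.recBotCoe with
      | bot => exact hf0.symm
      | coe v =>
        induction v using WithTop.recTopCoe with
        | top => exact hf1.symm
        | coe c => exact hA' c
    funext e
    rw [flowMap_apply, hv, hv]

/-- Affine maps commute with affine hulls, so injectivity on the hull serves both bijections; the
lattice points match because integrality passes through `flowMap` in both directions. -/
theorem integrallyEquivalent_pasmPolytope_flowPolytope (hlam : lam ≤ nu)
    (hnu : ∀ c ∈ nu, c.1 + 1 < m ∧ c.2 + 1 < n) (hG : IsTruncatedDual D G) :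
    IntegrallyEquivalent (pasmPolytope nu lam m n) (flowPolytope G) := by
  have himg := image_flowMap hlam hnu hG
  have hspan : (affineSpan ℝ (flowPolytope G) : Set _) =
      flowMap nu lam m n '' (affineSpan ℝ (pasmPolytope nu lam m n)) := by
    rw [← himg, ← AffineSubspace.map_span, AffineSubspace.coe_map]
  refine ⟨flowMap nu lam m n, ⟨?_, flowMap_injOn.mono (subset_affineSpan ℝ _), himg.ge⟩,
    ?_, flowMap_injOn.mono inter_subset_right, ?_⟩
  · rw [← himg]
    exact mapsTo_image _ _
  · rintro A ⟨hA, hA'⟩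
    exact ⟨flowMap_mem_integerPoints hA, hspan ▸ mem_image_of_mem _ hA'⟩
  · rintro y ⟨hy, hy'⟩
    rw [hspan] at hy'
    obtain ⟨A, hA, rfl⟩ := hy'
    exact ⟨A, ⟨mem_integerPoints_of_flowMap hA hy, hA⟩, rfl⟩

end Equivalence

/-! ### A drawing of the Hasse diagram of a skew shape

The box `(i, j)` is drawn at horizontal coordinate `j - i` and height `i + j`. The edges to the
bottom and to the top leave the boxes vertically and are then tapered towards a single point. -/

namespace SkewPoset

variable {nu lam : YoungDiagram}

/-- A box as a vertex of the extended poset. -/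
def box (c : SkewPoset nu lam) : PosetHat (SkewPoset nu lam) :=
  ((c : WithTop (SkewPoset nu lam)) : PosetHat (SkewPoset nu lam))

lemma hat_cases (v : PosetHat (SkewPoset nu lam)) : v = ⊥ ∨ v = ⊤ ∨ ∃ c, v = box c := by
  induction v using WithBot.recBotCoe with
  | bot => exact Or.inl rfl
  | coe v =>
    induction v using WithTop.recTopCoe with
    | top => exact Or.inr (Or.inl rfl)
    | coe c => exact Or.inr (Or.inr ⟨c, rfl⟩)

lemma box_lt_box {c d : SkewPoset nu lam} : box c < box d ↔ c < d := by
  simp [box, WithBot.coe_lt_coe, WithTop.coe_lt_coe]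

lemma box_covBy_box {c d : SkewPoset nu lam} : box c ⋖ box d ↔ c ⋖ d := by
  simp [box, WithBot.coe_covBy_coe, WithTop.coe_covBy_coe]

lemma bot_lt_box (c : SkewPoset nu lam) : ⊥ < box c := WithBot.bot_lt_coe _

lemma box_lt_top (c : SkewPoset nu lam) : box c < ⊤ :=
  WithBot.coe_lt_coe.2 (WithTop.coe_lt_top c)

lemma eq_of_coords {c d : SkewPoset nu lam} (h1 : c.1.1 = d.1.1) (h2 : c.1.2 = d.1.2) : c = d :=
  Subtype.ext (Prod.ext h1 h2)

/-- Covering pairs of boxes are neighbours. -/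
lemma covBy_step {c d : SkewPoset nu lam} (h : c ⋖ d) :
    (d.1.1 = c.1.1 + 1 ∧ d.1.2 = c.1.2) ∨ (d.1.1 = c.1.1 ∧ d.1.2 = c.1.2 + 1) := by
  have hle : c.1 ≤ d.1 := h.le
  -- A skew shape is convex in `ℕ × ℕ`, so nothing between two of its boxes is missing.
  have key : ∀ b : ℕ × ℕ, c.1 < b → b ≤ d.1 → d.1 = b := by
    intro b hcb hbd
    have hb : b ∈ nu ∧ b ∉ lam :=
      ⟨nu.isLowerSet hbd d.2.1, fun hb => c.2.2 (lam.isLowerSet hcb.le hb)⟩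
    by_contra hne
    exact h.2 (c := ⟨b, hb⟩) hcb (lt_of_le_of_ne hbd (fun h => hne (congrArg Subtype.val h).symm))
  obtain ⟨h1, h2⟩ := Prod.le_def.1 hle
  rcases h1.eq_or_lt with h1' | h1'
  · rcases h2.eq_or_lt with h2' | h2'
    · exact absurd (eq_of_coords h1' h2') h.lt.ne
    · have := key (c.1.1, c.1.2 + 1) (Prod.lt_iff.2 (Or.inr ⟨le_rfl, Nat.lt_succ_self _⟩))
        (Prod.le_def.2 ⟨h1, h2'⟩)
      exact Or.inr ⟨by rw [this], by rw [this]⟩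
  · have := key (c.1.1 + 1, c.1.2) (Prod.lt_iff.2 (Or.inl ⟨Nat.lt_succ_self _, le_rfl⟩))
        (Prod.le_def.2 ⟨h1', h2⟩)
    exact Or.inl ⟨by rw [this], by rw [this]⟩

def boxX (c : SkewPoset nu lam) : ℝ := (c.1.2 : ℝ) - c.1.1

def boxHeight (c : SkewPoset nu lam) : ℝ := (c.1.1 : ℝ) + c.1.2

def hatX : PosetHat (SkewPoset nu lam) → ℝ :=
  WithBot.recBotCoe 0 (WithTop.recTopCoe 0 boxX)

/-- With box heights in `[0, N]`, this leaves a strip of height one below and above the boxes for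
the tapering. -/
def hatHeight (N : ℕ) : PosetHat (SkewPoset nu lam) → ℝ :=
  WithBot.recBotCoe (-1) (WithTop.recTopCoe (N + 1) boxHeight)

/-- The horizontal coordinate of an edge before tapering. -/
def lineX : PosetHat (SkewPoset nu lam) → PosetHat (SkewPoset nu lam) → ℝ → ℝ :=
  WithBot.recBotCoe
    (WithBot.recBotCoe (fun _ => 0) (WithTop.recTopCoe (fun _ => 0) fun d _ => boxX d))
    (WithTop.recTopCoe (fun _ _ => 0) fun c => WithBot.recBotCoe (fun _ => 0)
      (WithTop.recTopCoe (fun _ => boxX c) fun d y =>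
        boxX c + (boxX d - boxX c) * (y - boxHeight c)))

/-- The factor that contracts the drawing towards the bottom and the top. -/
def taper (N : ℕ) (y : ℝ) : ℝ := min 1 (min (y + 1) (N + 1 - y))

lemma continuous_taper (N : ℕ) : Continuous (taper N) := by
  unfold taper
  fun_prop

lemma taper_bot (N : ℕ) : taper N (-1) = 0 := by
  have : (0 : ℝ) ≤ N := Nat.cast_nonneg N
  rw [taper, neg_add_cancel, min_eq_left (by linarith : (0 : ℝ) ≤ N + 1 - -1),
    min_eq_right zero_le_one]

lemma taper_top (N : ℕ) : taper N (N + 1) = 0 := by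
  have : (0 : ℝ) ≤ N := Nat.cast_nonneg N
  rw [taper, sub_self, min_eq_right (by linarith : (0 : ℝ) ≤ N + 1 + 1), min_eq_right zero_le_one]

lemma taper_eq_one {N : ℕ} {y : ℝ} (h0 : 0 ≤ y) (h1 : y ≤ N) : taper N y = 1 :=
  min_eq_left (le_min (by linarith) (by linarith))

lemma taper_pos {N : ℕ} {y : ℝ} (h0 : -1 < y) (h1 : y < N + 1) : 0 < taper N y :=
  lt_min one_pos (lt_min (by linarith) (by linarith))

lemma boxHeight_nonneg (c : SkewPoset nu lam) : 0 ≤ boxHeight c := by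
  unfold boxHeight
  positivity

lemma boxHeight_strictMono : StrictMono (boxHeight : SkewPoset nu lam → ℝ) := by
  intro c d h
  have h' : c.1 < d.1 := h
  have : c.1.1 + c.1.2 < d.1.1 + d.1.2 := by
    rcases Prod.lt_iff.1 h' with ⟨h1, h2⟩ | ⟨h1, h2⟩ <;> omega
  unfold boxHeight
  exact_mod_cast this

lemma eq_of_boxX_boxHeight {c d : SkewPoset nu lam} (hx : boxX c = boxX d)
    (hh : boxHeight c = boxHeight d) : c = d := by
  unfold boxX at hx
  unfold boxHeight at hh
  refine eq_of_coords ?_ ?_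
  · exact_mod_cast (by linarith : (c.1.1 : ℝ) = d.1.1)
  · exact_mod_cast (by linarith : (c.1.2 : ℝ) = d.1.2)

/-- Boxes on the same diagonal are ordered by their heights. -/
lemma lt_of_boxX_eq {c d : SkewPoset nu lam} (hx : boxX c = boxX d)
    (hh : boxHeight c < boxHeight d) : c < d := by
  unfold boxX at hx
  unfold boxHeight at hh
  change c.1 < d.1
  have h1 : c.1.1 < d.1.1 := by exact_mod_cast (by linarith : (c.1.1 : ℝ) < d.1.1)
  have h2 : c.1.2 < d.1.2 := by exact_mod_cast (by linarith : (c.1.2 : ℝ) < d.1.2)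
  exact Prod.lt_iff.2 (Or.inl ⟨h1, h2.le⟩)

variable {N : ℕ}

/-- The position of a point of an edge before tapering. -/
inductive EdgePoint (e : HasseEdge (SkewPoset nu lam)) (y : ℝ) : Prop
  | vertex (c : SkewPoset nu lam) (he : box c = e.1.1 ∨ box c = e.1.2)
      (hx : lineX e.1.1 e.1.2 y = boxX c) (hy : y = boxHeight c)
  | bottom (c : SkewPoset nu lam) (h1 : e.1.1 = ⊥) (h2 : e.1.2 = box c)
      (hx : lineX e.1.1 e.1.2 y = boxX c) (hy : y < boxHeight c)
  | top (c : SkewPoset nu lam) (h1 : e.1.1 = box c) (h2 : e.1.2 = ⊤)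
      (hx : lineX e.1.1 e.1.2 y = boxX c) (hy : boxHeight c < y)
  | inner (c d : SkewPoset nu lam) (h1 : e.1.1 = box c) (h2 : e.1.2 = box d) (σ : ℝ)
      (hσ : (σ = -1 ∧ d.1.1 = c.1.1 + 1 ∧ d.1.2 = c.1.2) ∨
        (σ = 1 ∧ d.1.1 = c.1.1 ∧ d.1.2 = c.1.2 + 1))
      (hx : lineX e.1.1 e.1.2 y = boxX c + σ * (y - boxHeight c))
      (hy : y ∈ Ioo (boxHeight c) (boxHeight c + 1))
  | empty (h1 : e.1.1 = ⊥) (h2 : e.1.2 = ⊤) (hx : lineX e.1.1 e.1.2 y = 0)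

lemma edgePoint (e : HasseEdge (SkewPoset nu lam)) {y : ℝ}
    (hy : y ∈ Icc (hatHeight N e.1.1) (hatHeight N e.1.2)) : EdgePoint e y := by
  obtain ⟨⟨p, q⟩, he⟩ := e
  simp only at hy he
  rcases hat_cases p with rfl | rfl | ⟨c, rfl⟩
  · rcases hat_cases q with rfl | rfl | ⟨d, rfl⟩
    · exact absurd he.lt (lt_irrefl _)
    · exact .empty rfl rfl rfl
    · have hy2 : y ≤ boxHeight d := hy.2
      rcases hy2.eq_or_lt with h | h
      · exact .vertex d (Or.inr rfl) rfl h
      · exact .bottom d rfl rfl rfl h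
  · exact absurd he.lt not_top_lt
  · have hy1 : boxHeight c ≤ y := hy.1
    rcases hat_cases q with rfl | rfl | ⟨d, rfl⟩
    · exact absurd he.lt not_lt_bot
    · rcases hy1.eq_or_lt with h | h
      · exact .vertex c (Or.inl rfl) rfl h.symm
      · exact .top c rfl rfl rfl h
    · have hy2 : y ≤ boxHeight d := hy.2
      have hcd := covBy_step (box_covBy_box.1 he)
      have hh : boxHeight d = boxHeight c + 1 := by
        unfold boxHeight
        rcases hcd with ⟨h1, h2⟩ | ⟨h1, h2⟩ <;> rw [h1, h2] <;> push_cast <;> ring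
      have hl : lineX (box c) (box d) y = boxX c + (boxX d - boxX c) * (y - boxHeight c) := rfl
      rcases hy1.eq_or_lt with h | h
      · exact .vertex c (Or.inl rfl) (by simp only [hl, h]; ring) h.symm
      rcases hy2.eq_or_lt with h' | h'
      · exact .vertex d (Or.inr rfl) (by change lineX (box c) (box d) y = _; rw [hl, h', hh]; ring) h'
      refine .inner c d rfl rfl (boxX d - boxX c) ?_ hl ⟨h, hh ▸ h'⟩
      unfold boxX
      rcases hcd with ⟨h1, h2⟩ | ⟨h1, h2⟩
      · exact Or.inl ⟨by rw [h1, h2]; push_cast; ring, h1, h2⟩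
      · exact Or.inr ⟨by rw [h1, h2]; push_cast; ring, h1, h2⟩

lemma not_lt_of_bot_covBy {c b : SkewPoset nu lam} (h : ⊥ ⋖ box c) : ¬ b < c := fun hb =>
  h.2 (bot_lt_box b) (box_lt_box.2 hb)

lemma not_lt_of_covBy_top {c b : SkewPoset nu lam} (h : box c ⋖ ⊤) : ¬ c < b := fun hb =>
  h.2 (box_lt_box.2 hb) (box_lt_top b)

lemma isEmpty_of_covBy (h : (⊥ : PosetHat (SkewPoset nu lam)) ⋖ ⊤) (c : SkewPoset nu lam) : False :=
  h.2 (bot_lt_box c) (box_lt_top c)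

lemma edge_ext {e e' : HasseEdge (SkewPoset nu lam)} (h1 : e.1.1 = e'.1.1) (h2 : e.1.2 = e'.1.2) :
    e = e' :=
  Subtype.ext (Prod.ext h1 h2)

/-- Before tapering, two edges meet only in boxes. -/
lemma exists_box_of_lineX_eq {e e' : HasseEdge (SkewPoset nu lam)} {y : ℝ} (hne : e ≠ e')
    (hy : EdgePoint e y) (hy' : EdgePoint e' y)
    (h : lineX e.1.1 e.1.2 y = lineX e'.1.1 e'.1.2 y) :
    ∃ c : SkewPoset nu lam, boxX c = lineX e.1.1 e.1.2 y ∧ boxHeight c = y := by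
  -- a fan edge and an inner edge do not meet at the same non-integral height
  have key : ∀ (b c : SkewPoset nu lam) (σ t : ℝ), σ = -1 ∨ σ = 1 → 0 < t → t < 1 →
      boxX b ≠ boxX c + σ * t := by
    intro b c σ t hσ h0 h1 h
    unfold boxX at h
    rcases hσ with rfl | rfl
    · have h2 : (0 : ℝ) < c.1.2 - c.1.1 - (b.1.2 - b.1.1) := by linarith
      have h3 : (c.1.2 - c.1.1 - (b.1.2 - b.1.1) : ℝ) < 1 := by linarith
      have h2' : (0 : ℤ) < c.1.2 - c.1.1 - (b.1.2 - b.1.1) := by exact_mod_cast h2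
      have h3' : (c.1.2 - c.1.1 - (b.1.2 - b.1.1) : ℤ) < 1 := by exact_mod_cast h3
      omega
    · have h2 : (0 : ℝ) < (b.1.2 - b.1.1) - (c.1.2 - c.1.1) := by linarith
      have h3 : ((b.1.2 - b.1.1) - (c.1.2 - c.1.1) : ℝ) < 1 := by linarith
      have h2' : (0 : ℤ) < (b.1.2 - b.1.1) - (c.1.2 - c.1.1) := by exact_mod_cast h2
      have h3' : ((b.1.2 - b.1.1) - (c.1.2 - c.1.1) : ℤ) < 1 := by exact_mod_cast h3
      omega
  have hsign : ∀ {σ : ℝ} {p q : Prop}, ((σ = -1 ∧ p) ∨ (σ = 1 ∧ q)) → σ = -1 ∨ σ = 1 :=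
    fun h => h.imp And.left And.left
  have hcov := e.2
  have hcov' := e'.2
  cases hy with
  | vertex c he hx hyc => exact ⟨c, hx.symm, hyc.symm⟩
  | empty h1 h2 hx =>
    rw [h1, h2] at hcov
    exfalso
    rcases hat_cases e'.1.1 with h' | h' | ⟨c, -⟩
    · rcases hat_cases e'.1.2 with h'' | h'' | ⟨c, -⟩
      · exact absurd hcov'.lt (by rw [h'']; exact not_lt_bot)
      · exact hne (edge_ext (h1.trans h'.symm) (h2.trans h''.symm))
      · exact isEmpty_of_covBy hcov c
    · exact absurd hcov'.lt (by rw [h']; exact not_top_lt)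
    · exact isEmpty_of_covBy hcov c
  | bottom c h1 h2 hx hyc =>
    rw [h1, h2] at hcov
    cases hy' with
    | vertex c' he' hx' hyc' => exact ⟨c', (h.trans hx').symm, hyc'.symm⟩
    | empty h1' h2' hx' => rw [h1', h2'] at hcov'; exact (isEmpty_of_covBy hcov' c).elim
    -- Vertical edges that meet belong to boxes on one diagonal, which are comparable; this
    -- contradicts minimality of one of the boxes unless they are equal.
    | bottom c' h1' h2' hx' hyc' =>
      rw [h1', h2'] at hcov'
      have hxx : boxX c = boxX c' := by rw [← hx, h, hx']
      rcases lt_trichotomy (boxHeight c) (boxHeight c') with hh | hh | hh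
      · exact (not_lt_of_bot_covBy hcov' (lt_of_boxX_eq hxx hh)).elim
      · exact (hne (edge_ext (h1.trans h1'.symm)
          (by rw [h2, h2', eq_of_boxX_boxHeight hxx hh]))).elim
      · exact (not_lt_of_bot_covBy hcov (lt_of_boxX_eq hxx.symm hh)).elim
    | top c' h1' h2' hx' hyc' =>
      exact (not_lt_of_bot_covBy hcov
        (lt_of_boxX_eq (by rw [← hx, h, hx']) (hyc'.trans hyc))).elim
    | inner c' d' h1' h2' σ hσ hx' hyc' =>
      exact (key c c' σ (y - boxHeight c') (hsign hσ) (by linarith [hyc'.1]) (by linarith [hyc'.2])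
        (by rw [← hx, h, hx'])).elim
  | top c h1 h2 hx hyc =>
    rw [h1, h2] at hcov
    cases hy' with
    | vertex c' he' hx' hyc' => exact ⟨c', (h.trans hx').symm, hyc'.symm⟩
    | empty h1' h2' hx' => rw [h1', h2'] at hcov'; exact (isEmpty_of_covBy hcov' c).elim
    | bottom c' h1' h2' hx' hyc' =>
      rw [h1', h2'] at hcov'
      exact (not_lt_of_bot_covBy hcov'
        (lt_of_boxX_eq (by rw [← hx, h, hx']) (hyc.trans hyc'))).elim
    | top c' h1' h2' hx' hyc' =>
      rw [h1', h2'] at hcov'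
      have hxx : boxX c = boxX c' := by rw [← hx, h, hx']
      rcases lt_trichotomy (boxHeight c) (boxHeight c') with hh | hh | hh
      · exact (not_lt_of_covBy_top hcov (lt_of_boxX_eq hxx hh)).elim
      · exact (hne (edge_ext (by rw [h1, h1', eq_of_boxX_boxHeight hxx hh])
          (h2.trans h2'.symm))).elim
      · exact (not_lt_of_covBy_top hcov' (lt_of_boxX_eq hxx.symm hh)).elim
    | inner c' d' h1' h2' σ hσ hx' hyc' =>
      exact (key c c' σ (y - boxHeight c') (hsign hσ) (by linarith [hyc'.1]) (by linarith [hyc'.2])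
        (by rw [← hx, h, hx'])).elim
  | inner c d h1 h2 σ hσ hx hyc =>
    cases hy' with
    | vertex c' he' hx' hyc' => exact ⟨c', (h.trans hx').symm, hyc'.symm⟩
    | empty h1' h2' hx' => rw [h1', h2'] at hcov'; exact (isEmpty_of_covBy hcov' c).elim
    | bottom c' h1' h2' hx' hyc' =>
      exact (key c' c σ (y - boxHeight c) (hsign hσ) (by linarith [hyc.1]) (by linarith [hyc.2])
        (by rw [← hx, h, hx'])).elim
    | top c' h1' h2' hx' hyc' =>
      exact (key c' c σ (y - boxHeight c) (hsign hσ) (by linarith [hyc.1]) (by linarith [hyc.2])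
        (by rw [← hx, h, hx'])).elim
    | inner c' d' h1' h2' σ' hσ' hx' hyc' =>
      exfalso
      have hxx : boxX c + σ * (y - boxHeight c) = boxX c' + σ' * (y - boxHeight c') := by
        rw [← hx, h, hx']
      -- Inner edges live strictly between consecutive integral heights, so edges sharing a height
      -- start at the same level.
      have hsum : c.1.1 + c.1.2 = c'.1.1 + c'.1.2 := by
        have ha : boxHeight c < boxHeight c' + 1 := hyc.1.trans hyc'.2
        have hb : boxHeight c' < boxHeight c + 1 := hyc'.1.trans hyc.2
        unfold boxHeight at ha hb
        have ha' : c.1.1 + c.1.2 < c'.1.1 + c'.1.2 + 1 := by exact_mod_cast ha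
        have hb' : c'.1.1 + c'.1.2 < c.1.1 + c.1.2 + 1 := by exact_mod_cast hb
        omega
      have hh : boxHeight c = boxHeight c' := by
        unfold boxHeight
        exact_mod_cast hsum
      have hsumR : (c.1.1 : ℝ) + c.1.2 = c'.1.1 + c'.1.2 := hh
      rw [hh] at hxx hyc
      obtain ⟨ht0, ht1⟩ := hyc
      rcases hσ with ⟨rfl, hd1, hd2⟩ | ⟨rfl, hd1, hd2⟩ <;>
        rcases hσ' with ⟨rfl, hd1', hd2'⟩ | ⟨rfl, hd1', hd2'⟩
      · have hc : c = c' := eq_of_boxX_boxHeight (by linarith) hh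
        subst hc
        exact hne (edge_ext (h1.trans h1'.symm) (by
          rw [h2, h2', eq_of_coords (hd1.trans hd1'.symm) (hd2.trans hd2'.symm)]))
      -- Edges of opposite slope starting at the same level could meet only if two column indices
      -- differed by a number strictly between `0` and `1`.
      · unfold boxX at hxx
        have ha : (c'.1.2 : ℝ) < c.1.2 := by linarith
        have hb : (c.1.2 : ℝ) < c'.1.2 + 1 := by linarith
        have ha' : c'.1.2 < c.1.2 := by exact_mod_cast ha
        have hb' : c.1.2 < c'.1.2 + 1 := by exact_mod_cast hb
        omega
      · unfold boxX at hxx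
        have ha : (c.1.2 : ℝ) < c'.1.2 := by linarith
        have hb : (c'.1.2 : ℝ) < c.1.2 + 1 := by linarith
        have ha' : c.1.2 < c'.1.2 := by exact_mod_cast ha
        have hb' : c'.1.2 < c.1.2 + 1 := by exact_mod_cast hb
        omega
      · have hc : c = c' := eq_of_boxX_boxHeight (by linarith) hh
        subst hc
        exact hne (edge_ext (h1.trans h1'.symm) (by
          rw [h2, h2', eq_of_coords (hd1.trans hd1'.symm) (hd2.trans hd2'.symm)]))

lemma continuous_lineX (p q : PosetHat (SkewPoset nu lam)) : Continuous (lineX p q) := by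
  rcases hat_cases p with rfl | rfl | ⟨c, rfl⟩
  · rcases hat_cases q with rfl | rfl | ⟨d, rfl⟩ <;> exact continuous_const
  · exact continuous_const
  · rcases hat_cases q with rfl | rfl | ⟨d, rfl⟩
    · exact continuous_const
    · exact continuous_const
    · change Continuous fun y => boxX c + (boxX d - boxX c) * (y - boxHeight c)
      fun_prop

section Bounded

variable (hN : ∀ c : SkewPoset nu lam, c.1.1 + c.1.2 ≤ N)

include hN

lemma boxHeight_le (c : SkewPoset nu lam) : boxHeight c ≤ N := by
  unfold boxHeight
  exact_mod_cast hN c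

lemma hatHeight_strictMono : StrictMono (hatHeight N : PosetHat (SkewPoset nu lam) → ℝ) := by
  intro a b hab
  have hN0 : (0 : ℝ) ≤ N := Nat.cast_nonneg N
  rcases hat_cases a with rfl | rfl | ⟨c, rfl⟩
  · rcases hat_cases b with rfl | rfl | ⟨d, rfl⟩
    · exact absurd hab (lt_irrefl _)
    · change (-1 : ℝ) < N + 1
      linarith
    · change (-1 : ℝ) < boxHeight d
      linarith [boxHeight_nonneg d]
  · exact absurd hab not_top_lt
  · rcases hat_cases b with rfl | rfl | ⟨d, rfl⟩
    · exact absurd hab not_lt_bot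
    · change boxHeight c < N + 1
      linarith [boxHeight_le hN c]
    · exact boxHeight_strictMono (box_lt_box.1 hab)

lemma taper_boxHeight (c : SkewPoset nu lam) : taper N (boxHeight c) = 1 :=
  taper_eq_one (boxHeight_nonneg c) (boxHeight_le hN c)

/-- The bound is strict, so that the tapered lines at `-(N + 1)` and `N + 1` can serve as the
additional edges. -/
lemma abs_lineX_lt (e : HasseEdge (SkewPoset nu lam)) {y : ℝ}
    (hy : y ∈ Icc (hatHeight N e.1.1) (hatHeight N e.1.2)) :
    |lineX e.1.1 e.1.2 y| < N + 1 := by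
  have hN0 : (0 : ℝ) ≤ N := Nat.cast_nonneg N
  have hb : ∀ c : SkewPoset nu lam, -(N : ℝ) ≤ boxX c ∧ boxX c ≤ N := by
    intro c
    have h1 := boxHeight_le hN c
    unfold boxHeight at h1
    unfold boxX
    have h2 : (0 : ℝ) ≤ c.1.1 := Nat.cast_nonneg _
    have h3 : (0 : ℝ) ≤ c.1.2 := Nat.cast_nonneg _
    constructor <;> linarith
  rw [abs_lt]
  cases edgePoint e hy with
  | vertex c he hx hyc => rw [hx]; constructor <;> linarith [hb c]
  | bottom c h1 h2 hx hyc => rw [hx]; constructor <;> linarith [hb c]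
  | top c h1 h2 hx hyc => rw [hx]; constructor <;> linarith [hb c]
  | empty h1 h2 hx => rw [hx]; constructor <;> linarith
  | inner c d h1 h2 σ hσ hx hyc =>
    rw [hx]
    obtain ⟨b1, b2⟩ := hb c
    obtain ⟨c1, c2⟩ := hyc
    rcases hσ with ⟨rfl, -⟩ | ⟨rfl, -⟩ <;> constructor <;> linarith

lemma curve_lower (e : HasseEdge (SkewPoset nu lam)) :
    lineX e.1.1 e.1.2 (hatHeight N e.1.1) * taper N (hatHeight N e.1.1) = hatX e.1.1 := by
  obtain ⟨⟨p, q⟩, he⟩ := e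
  simp only at he ⊢
  rcases hat_cases p with rfl | rfl | ⟨c, rfl⟩
  · change _ * taper N (-1) = 0
    rw [taper_bot, mul_zero]
  · exact absurd he.lt not_top_lt
  · change _ * taper N (boxHeight c) = boxX c
    rw [taper_boxHeight hN, mul_one]
    rcases hat_cases q with rfl | rfl | ⟨d, rfl⟩
    · exact absurd he.lt not_lt_bot
    · rfl
    · change boxX c + (boxX d - boxX c) * (boxHeight c - boxHeight c) = boxX c
      ring

lemma curve_upper (e : HasseEdge (SkewPoset nu lam)) :
    lineX e.1.1 e.1.2 (hatHeight N e.1.2) * taper N (hatHeight N e.1.2) = hatX e.1.2 := by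
  obtain ⟨⟨p, q⟩, he⟩ := e
  simp only at he ⊢
  rcases hat_cases q with rfl | rfl | ⟨d, rfl⟩
  · exact absurd he.lt not_lt_bot
  · change _ * taper N (N + 1) = 0
    rw [taper_top, mul_zero]
  · change _ * taper N (boxHeight d) = boxX d
    rw [taper_boxHeight hN, mul_one]
    rcases hat_cases p with rfl | rfl | ⟨c, rfl⟩
    · rfl
    · exact absurd he.lt not_top_lt
    · change boxX c + (boxX d - boxX c) * (boxHeight d - boxHeight c) = boxX d
      have : boxHeight d - boxHeight c = 1 := by
        unfold boxHeight
        rcases covBy_step (box_covBy_box.1 he) with ⟨h1, h2⟩ | ⟨h1, h2⟩ <;>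
          rw [h1, h2] <;> push_cast <;> ring
      rw [this]
      ring

lemma eq_end_of_mem (e : HasseEdge (SkewPoset nu lam)) (v : PosetHat (SkewPoset nu lam))
    (hv : hatHeight N v ∈ Icc (hatHeight N e.1.1) (hatHeight N e.1.2))
    (h : lineX e.1.1 e.1.2 (hatHeight N v) * taper N (hatHeight N v) = hatX v) :
    v = e.1.1 ∨ v = e.1.2 := by
  have hmono := hatHeight_strictMono hN
  rcases hat_cases v with rfl | rfl | ⟨b, rfl⟩
  · left
    by_contra hne
    exact absurd hv.1 (hmono (bot_lt_iff_ne_bot.2 (Ne.symm hne))).not_ge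
  · right
    by_contra hne
    exact absurd hv.2 (hmono (lt_top_iff_ne_top.2 (Ne.symm hne))).not_ge
  · have hcov := e.2
    change lineX e.1.1 e.1.2 (boxHeight b) * taper N (boxHeight b) = boxX b at h
    rw [taper_boxHeight hN, mul_one] at h
    cases (edgePoint e hv : EdgePoint e (boxHeight b)) with
    | vertex c he hx hyc =>
      rw [eq_of_boxX_boxHeight (h.symm.trans hx) hyc]
      exact he
    | bottom c h1 h2 hx hyc =>
      rw [h1, h2] at hcov
      exact absurd (lt_of_boxX_eq (h.symm.trans hx) hyc) (not_lt_of_bot_covBy hcov)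
    | top c h1 h2 hx hyc =>
      rw [h1, h2] at hcov
      exact absurd (lt_of_boxX_eq (hx.symm.trans h) hyc) (not_lt_of_covBy_top hcov)
    | empty h1 h2 hx =>
      rw [h1, h2] at hcov
      exact (isEmpty_of_covBy hcov b).elim
    -- A box has integral height, but the interior of an inner edge contains no integral height.
    | inner c d h1 h2 σ hσ hx hyc =>
      exfalso
      obtain ⟨ha, hb⟩ := hyc
      unfold boxHeight at ha hb
      have ha' : c.1.1 + c.1.2 < b.1.1 + b.1.2 := by exact_mod_cast ha
      have hb' : b.1.1 + b.1.2 < c.1.1 + c.1.2 + 1 := by exact_mod_cast hb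
      omega

/-- The drawing of the Hasse diagram of a skew shape. -/
def drawing : HasseDrawing (SkewPoset nu lam) where
  pos v := (hatX v, hatHeight N v)
  pos_injective := by
    have hmono := hatHeight_strictMono hN
    intro a b hab
    obtain ⟨hx, hh⟩ := Prod.ext_iff.1 hab
    simp only at hx hh
    rcases hat_cases a with rfl | rfl | ⟨c, rfl⟩
    · by_contra hne
      exact hh.not_lt (hmono (bot_lt_iff_ne_bot.2 (Ne.symm hne)))
    · by_contra hne
      exact hh.not_gt (hmono (lt_top_iff_ne_top.2 (Ne.symm hne)))
    · rcases hat_cases b with rfl | rfl | ⟨d, rfl⟩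
      · exact absurd hh (hmono (bot_lt_box c)).ne'
      · exact absurd hh (hmono (box_lt_top c)).ne
      · rw [eq_of_boxX_boxHeight hx hh]
  height_strictMono := hatHeight_strictMono hN
  curve e y := lineX e.1.1 e.1.2 y * taper N y
  curve_continuousOn e := ((continuous_lineX _ _).mul (continuous_taper N)).continuousOn
  curve_lower := curve_lower hN
  curve_upper := curve_upper hN
  vertex_on_curve := eq_end_of_mem hN
  curve_inter e e' y hne hy hy' h := by
    simp only at hy hy' h ⊢
    have hmono := (hatHeight_strictMono hN).monotone
    have hbot : -1 ≤ y := (hmono bot_le : hatHeight N ⊥ ≤ _).trans hy.1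
    have htop : y ≤ N + 1 := hy.2.trans (hmono le_top : _ ≤ hatHeight N ⊤)
    -- At the extreme heights the taper vanishes and all curves pass through `⊥` or `⊤`; elsewhere
    -- the positive factor cancels and the untapered lines decide.
    rcases hbot.eq_or_lt with rfl | hbot
    · exact ⟨⊥, by rw [taper_bot, mul_zero]; rfl⟩
    rcases htop.eq_or_lt with rfl | htop
    · exact ⟨⊤, by rw [taper_top, mul_zero]; rfl⟩
    obtain ⟨c, hc, hc'⟩ := exists_box_of_lineX_eq hne (edgePoint e hy) (edgePoint e' hy')
      (mul_right_cancel₀ (taper_pos hbot htop).ne' h)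
    refine ⟨box c, Prod.ext ?_ hc'⟩
    change boxX c = lineX e.1.1 e.1.2 y * taper N y
    rw [hc, ← hc', taper_boxHeight hN, mul_one]

/-- The drawing of the augmented Hasse diagram of a skew shape. -/
def augmentedDrawing : AugmentedDrawing (SkewPoset nu lam) where
  toHasseDrawing := drawing hN
  leftCurve y := -(N + 1) * taper N y
  rightCurve y := (N + 1) * taper N y
  left_continuousOn := (continuous_const.mul (continuous_taper N)).continuousOn
  right_continuousOn := (continuous_const.mul (continuous_taper N)).continuousOn
  left_bot := by
    change _ * taper N (-1) = 0
    rw [taper_bot, mul_zero]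
  left_top := by
    change _ * taper N (N + 1) = 0
    rw [taper_top, mul_zero]
  right_bot := by
    change _ * taper N (-1) = 0
    rw [taper_bot, mul_zero]
  right_top := by
    change _ * taper N (N + 1) = 0
    rw [taper_top, mul_zero]
  left_lt y hy e he :=
    mul_lt_mul_of_pos_right (abs_lt.1 (abs_lineX_lt hN e he)).1 (taper_pos hy.1 hy.2)
  lt_right y hy e he :=
    mul_lt_mul_of_pos_right (abs_lt.1 (abs_lineX_lt hN e he)).2 (taper_pos hy.1 hy.2)

end Bounded

end SkewPoset

end

theorem mainTheorem5 (m n : ℕ) (hm : 0 < m) (hn : 0 < n) (nu lam : YoungDiagram)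
    (hlam : lam ≤ nu) (hnu : ∀ c ∈ nu, c.1 + 1 < m ∧ c.2 + 1 < n) :
    StronglyPlanar (SkewPoset nu lam) ∧
    Nonempty (AugmentedDrawing (SkewPoset nu lam)) ∧
    ∀ D : AugmentedDrawing (SkewPoset nu lam),
      (∃ (k : ℕ) (G : OrderedGraph k (HasseEdge (SkewPoset nu lam))), IsTruncatedDual D G) ∧
      ∀ (k : ℕ) (G : OrderedGraph k (HasseEdge (SkewPoset nu lam))), IsTruncatedDual D G →
        IntegrallyEquivalent (pasmPolytope nu lam m n) (flowPolytope G) := by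
  have hN : ∀ c : SkewPoset nu lam, c.1.1 + c.1.2 ≤ m + n := fun c => by
    have := hnu c.1 c.2.1
    omega
  exact ⟨⟨SkewPoset.drawing hN⟩, ⟨SkewPoset.augmentedDrawing hN⟩, fun D =>
    ⟨D.exists_isTruncatedDual, fun k G hG =>
      integrallyEquivalent_pasmPolytope_flowPolytope hlam hnu hG⟩⟩
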